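/- Let $a<b$, $\alpha>0$ and $1<\beta\le 2$. For an interval $I=(A,B)$ with $-\infty\le A<B\le\infty$ and $\gamma>0$, $n=\lceil\gamma\rceil$, the Riemann--Liouville derivatives are $${}_AD_x^{\gamma}v(x)=\frac{d^n}{dx^n}\,\frac{1}{\Gamma(n-\gamma)}\int_A^x\frac{v(\zeta)\,d\zeta}{(x-\zeta)^{1-n+\gamma}},\qquad {}_xD_B^{\gamma}v(x)=(-1)^n\frac{d^n}{dx^n}\,\frac{1}{\Gamma(n-\gamma)}\int_x^B\frac{v(\zeta)\,d\zeta}{(\zeta-x)^{1-n+\gamma}}$$ (for $\gamma=n$: $D^nv$ and $(-1)^nD^nv$), where $d^n/dx^n$ is the classical derivative at every point of $I$, and the Riesz derivative is ${}_A\mathbb D_B^{\gamma}v=-\frac{1}{2\cos(\gamma\pi/2)}\left({}_AD_x^{\gamma}v+{}_xD_B^{\gamma}v\right)$. Consider the problem $$\alpha u(x)+\cos\left(\tfrac{\beta\pi}{2}\right)\,{}_a\mathbb D_b^{\beta}u(x)=f(x),\quad x\in(a,b),\qquad u(a)=u(b)=0. \tag{P}$$ For an integer $M\ge 1$ let $h=(b-a)/M$,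 $x_j=a+jh$ $(0\le j\le M)$. With $$\widetilde w_k=-\frac{(-1)^k\,\Gamma(\beta+1)}{\Gamma(\frac\beta2-k+1)\,\Gamma(\frac\beta2+k+1)}\quad(k\in\mathbb Z,\ 1/\Gamma=0 \text{ at the poles of }\Gamma),\qquad \Delta_x^{\beta}v_j=\frac1{h^{\beta}}\sum_{k=j-M}^{j}\widetilde w_k\,v_{j-k},$$ the fractional centered difference (FCD) scheme with right-hand side $(F_j)_{1\le j\le M-1}$ is $$\alpha U_j+\cos\left(\tfrac{\beta\pi}{2}\right)\Delta_x^{\beta}U_j=F_j,\quad 1\le j\le M-1,\qquad U_0=U_M=0. \tag{S}$$ Write $\|v\|_\infty=\max_{1\le j\le M-1}|v_j|$ (with $\|v\|_\infty=0$ if $M=1$). Then: 1. (Unique solvability) For every $M\ge1$ and every right-hand side $F$, the scheme (S) has exactly one solution. 2. (Unconditional stability) There is a constant $C>0$, independent of $M$ and of the right-hand sides, such that for all $M\ge 1$ and all right-hand sides $F,G$ the solutions $U,V$ of (S) with right-hand sides $F,G$ satisfy $\|U-V\|_\infty\le C\,\|F-G\|_\infty$. 3. (Second-order convergence) Let $u$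 be continuous on $[a,b]$ and solve (P), and let $\widetilde u$ be its extension by zero to $\mathbb R$. Suppose that $\widetilde u\in L_1(\mathbb R)$, that ${}_{-\infty}\mathbb D_{+\infty}^{\beta+2}\widetilde u$ exists on $\mathbb R$, and that it and its Fourier transform belong to $L_1(\mathbb R)$. Then there is a constant $c>0$, independent of $M$, such that for all $M\ge1$ the solution $U$ of (S) with $F_j=f(x_j)$ satisfies $$\max_{1\le j\le M-1}|u(x_j)-U_j|\le c\,h^2 .$$ -/

import Mathlib

open scoped FourierTransform NNReal

noncomputable section

namespace RieszFCD

/-- Left-sided Riemann-Liouville integral of order `s ∈ [0,1)` over an interval `I`: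
`(1/Γ(s)) ∫_{ζ ∈ I, ζ < x} v(ζ) / (x-ζ)^{1-s} dζ`, and the identity for `s = 0`.
`I = (a,b)` gives lower limit `a`; `I = ℝ` gives lower limit `-∞`. -/
def leftRLIntegral (I : Set ℝ) (s : ℝ) (v : ℝ → ℝ) (x : ℝ) : ℝ :=
  if s = 0 then v x
  else 1 / Real.Gamma s * ∫ ζ in I ∩ Set.Iio x, v ζ / (x - ζ) ^ (1 - s)

/-- Right-sided Riemann-Liouville integral of order `s ∈ [0,1)` over an interval `I`:
`(1/Γ(s)) ∫_{ζ ∈ I, ζ > x} v(ζ) / (ζ-x)^{1-s} dζ`, and the identity for `s = 0`. -/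
def rightRLIntegral (I : Set ℝ) (s : ℝ) (v : ℝ → ℝ) (x : ℝ) : ℝ :=
  if s = 0 then v x
  else 1 / Real.Gamma s * ∫ ζ in I ∩ Set.Ioi x, v ζ / (ζ - x) ^ (1 - s)

/-- Left-sided Riemann-Liouville derivative of order `γ > 0`: with `n = ⌈γ⌉`, the classical
`n`-th derivative of the left-sided integral of order `n - γ`. -/
def leftRLDeriv (I : Set ℝ) (γ : ℝ) (v : ℝ → ℝ) (x : ℝ) : ℝ :=
  iteratedDeriv ⌈γ⌉₊ (leftRLIntegral I ((⌈γ⌉₊ : ℝ) - γ) v) x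

/-- Right-sided Riemann-Liouville derivative of order `γ > 0`. -/
def rightRLDeriv (I : Set ℝ) (γ : ℝ) (v : ℝ → ℝ) (x : ℝ) : ℝ :=
  (-1) ^ ⌈γ⌉₊ * iteratedDeriv ⌈γ⌉₊ (rightRLIntegral I ((⌈γ⌉₊ : ℝ) - γ) v) x

/-- Both Riemann-Liouville derivatives of order `γ` of `v` over `I` exist at all points of the
open set `I`: the two integrals of order `⌈γ⌉ - γ` are `⌈γ⌉` times differentiable on `I`. -/
def RLDifferentiableOn (I : Set ℝ) (γ : ℝ) (v : ℝ → ℝ) : Prop :=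
  ∀ x ∈ I, ∀ m < ⌈γ⌉₊,
    DifferentiableAt ℝ (iteratedDeriv m (leftRLIntegral I ((⌈γ⌉₊ : ℝ) - γ) v)) x ∧
    DifferentiableAt ℝ (iteratedDeriv m (rightRLIntegral I ((⌈γ⌉₊ : ℝ) - γ) v)) x

/-- The Riesz derivative of order `γ` over `I`:
`-(1 / (2 cos(γπ/2))) (left derivative + right derivative)`. -/
def rieszDeriv (I : Set ℝ) (γ : ℝ) (v : ℝ → ℝ) (x : ℝ) : ℝ :=
  -(1 / (2 * Real.cos (γ * Real.pi / 2))) * (leftRLDeriv I γ v x + rightRLDeriv I γ v x)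

/-- `u` is a (continuous) solution of `α u + cos(βπ/2) · (Riesz derivative of order β of u) = f`
in `(a,b)`, `u(a) = u(b) = 0`. -/
structure IsRieszSolution (a b α β : ℝ) (f u : ℝ → ℝ) : Prop where
  continuousOn : ContinuousOn u (Set.Icc a b)
  left : u a = 0
  right : u b = 0
  differentiable : RLDifferentiableOn (Set.Ioo a b) β u
  equation : ∀ x ∈ Set.Ioo a b,
    α * u x + Real.cos (β * Real.pi / 2) * rieszDeriv (Set.Ioo a b) β u x = f x

/-- The extension by zero of `u` from `[a,b]` to the real line. -/
def zeroExt (a b : ℝ) (u : ℝ → ℝ) : ℝ → ℝ := (Set.Icc a b).indicator u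

/-- Smoothness assumption: `v` is integrable, its Riesz derivative of order `β + 2` over the whole
line exists, and this derivative and its Fourier transform are integrable. -/
structure IsFCDRegular (β : ℝ) (v : ℝ → ℝ) : Prop where
  integrable : MeasureTheory.Integrable v
  differentiable : RLDifferentiableOn Set.univ (β + 2) v
  integrable_deriv : MeasureTheory.Integrable (rieszDeriv Set.univ (β + 2) v)
  integrable_fourier :
    MeasureTheory.Integrable (𝓕 (fun x : ℝ => (rieszDeriv Set.univ (β + 2) v x : ℂ)))

/-- Weights of the fractional centered difference,
`-(-1)^k Γ(β+1) / (Γ(β/2-k+1) Γ(β/2+k+1))`. For `β = 2` and `|k| ≥ 2` the denominator has a pole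
of `Γ`, where Mathlib's `Γ` is `0` and the weight is `0`, as it should be. -/
def weight (β : ℝ) (k : ℤ) : ℝ :=
  -((-1) ^ k * Real.Gamma (β + 1) /
    (Real.Gamma (β / 2 - k + 1) * Real.Gamma (β / 2 + k + 1)))

/-- The step size `h = (b-a)/M`. -/
def step (a b : ℝ) (M : ℕ) : ℝ := (b - a) / M

/-- The grid point `x_j = a + j h`. -/
def node (a b : ℝ) (M : ℕ) (j : Fin (M + 1)) : ℝ := a + (j : ℕ) * step a b M

/-- The interior indices `1 ≤ j ≤ M-1`. -/
def interiorIdx (M : ℕ) : Finset (Fin (M + 1)) :=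
  Finset.univ.filter fun j => 0 < (j : ℕ) ∧ (j : ℕ) < M

/-- The fractional centered difference `h^{-β} ∑_{k=j-M}^{j} w_k v_{j-k}`, summed over
`i = j - k ∈ {0,…,M}`. -/
def centeredDiff (a b β : ℝ) (M : ℕ) (v : Fin (M + 1) → ℝ) (j : Fin (M + 1)) : ℝ :=
  1 / step a b M ^ β * ∑ i : Fin (M + 1), weight β (((j : ℕ) : ℤ) - ((i : ℕ) : ℤ)) * v i

/-- `U` solves the fractional centered difference scheme with right-hand side `F`. -/
structure IsFCDSolution (a b α β : ℝ) (M : ℕ) (F U : Fin (M + 1) → ℝ) : Prop where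
  left : U 0 = 0
  right : U (Fin.last M) = 0
  equation : ∀ j ∈ interiorIdx M,
    α * U j + Real.cos (β * Real.pi / 2) * centeredDiff a b β M U j = F j

/-- `max_{1 ≤ j ≤ M-1} |v_j|` (and `0` if there are no interior nodes). -/
def maxNorm {M : ℕ} (v : Fin (M + 1) → ℝ) : ℝ :=
  ((interiorIdx M).sup fun j => ‖v j‖₊ : ℝ≥0)

end RieszFCD

end

open RieszFCD

/-! The weights are the Fourier coefficients of `-|2 sin πx|^β`: only `w_0` is negative, the others
are nonnegative, and all sum to zero because the symbol vanishes at `x = 0`. Since `cos(βπ/2) < 0`,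
the matrix of the scheme is `α` times the identity plus a weakly diagonally dominant matrix of the
right signs. Reading the equation at a node where `|U|` is largest gives `‖U‖ ≤ ‖F‖/α`
(`maxNorm_le_of_isFCDSolution`). Stability follows by linearity, and unique solvability because an
injective endomorphism of a finite-dimensional space is bijective.

For convergence, the exact solution satisfies the scheme up to the consistency error, so stability
reduces everything to an `O(h²)` bound for that error. Let `v` be the zero extension. At interior
nodes the discrete operator is a whole-line difference of `v`, with Fourier multiplier `-h^{-β}|2
sin πhω|^β`, while the Riesz derivative has multiplier `-|2πω|^β`. The multipliers differ by at most
`(h²/4)|2πω|^{β+2}` (`sinSymbol_consistency`), so it suffices that `|2πω|^{β+2} 𝓕v` is integrable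
and that the classical Riesz derivative really is given by its multiplier.

Both facts come from one Riesz potential of order `s = 2 - β`: its second derivative gives order `β`
and its fourth gives order `β + 2`. The potential is in general not integrable, so its multiplier is
found weakly, by pairing with `𝓕 χ` for Schwartz `χ` (`integral_rieszPot_mul_fourier`); the kernel
`|x|^{s-1}` is handled as a superposition of Gaussians. Integration by parts moves derivatives onto
`𝓕 χ`. Testing against all `χ` identifies the transform of the fourth derivative, hence the
integrability, and then recovers the second derivative pointwise by continuity. -/

/-! ### Signs and summability of the weights. -/

theorem weight_neg (β : ℝ) (k : ℤ) : weight β (-k) = weight β k := by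
  have h : ((-1 : ℝ)) ^ (-k) = (-1) ^ k := by
    rw [zpow_neg, ← inv_zpow]; norm_num
  unfold weight
  rw [h]
  push_cast
  rw [sub_neg_eq_add, ← sub_eq_add_neg, mul_comm (Real.Gamma (β / 2 + k + 1))]

/-- `Γ(z + 1) = zΓ(z)` in both Gamma factors. This recurrence is the source of the signs, the
partial sums and the identification with Fourier coefficients. -/
theorem weight_succ {β : ℝ} (hβ : 0 < β) (k : ℕ) :
    (k + 1 + β / 2) * weight β (k + 1 : ℕ) = (k - β / 2) * weight β k := by
  have h1 : Real.Gamma (β / 2 + k + 1 + 1) = (β / 2 + k + 1) * Real.Gamma (β / 2 + k + 1) :=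
    Real.Gamma_add_one (by positivity)
  have hpos : 0 < Real.Gamma (β / 2 + k + 1) := Real.Gamma_pos_of_pos (by positivity)
  have hk : (0 : ℝ) < β / 2 + k + 1 := by positivity
  unfold weight
  push_cast
  rw [show β / 2 - ((k : ℝ) + 1) + 1 = β / 2 - k by ring,
    show β / 2 + ((k : ℝ) + 1) + 1 = β / 2 + k + 1 + 1 by ring, h1, zpow_add_one₀ (by norm_num)]
  -- The functional equation fails at `0`, but there the convention `Γ(0) = 0` makes the left side
  -- vanish, as does the factor `k - β/2` on the right.
  rcases eq_or_ne (β / 2 - k) 0 with h0 | h0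
  · rw [h0, Real.Gamma_zero, show (k : ℝ) - β / 2 = 0 by linarith]; simp
  · rw [Real.Gamma_add_one h0, show (k : ℝ) - β / 2 = -(β / 2 - k) by ring,
      show (k : ℝ) + 1 + β / 2 = β / 2 + k + 1 by ring]
    generalize β / 2 - (k : ℝ) = y at h0 ⊢
    generalize β / 2 + (k : ℝ) + 1 = z at hk hpos ⊢
    rcases eq_or_ne (Real.Gamma y) 0 with h2 | h2
    · simp [h2]
    · field_simp

theorem weight_zero_neg {β : ℝ} (hβ : 0 < β) : weight β 0 < 0 := by
  unfold weight
  have h1 : 0 < Real.Gamma (β + 1) := Real.Gamma_pos_of_pos (by positivity)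
  have h2 : 0 < Real.Gamma (β / 2 + 1) := Real.Gamma_pos_of_pos (by positivity)
  simp only [zpow_zero, Int.cast_zero, sub_zero, add_zero, one_mul]
  have : 0 < Real.Gamma (β + 1) / (Real.Gamma (β / 2 + 1) * Real.Gamma (β / 2 + 1)) := by positivity
  linarith

/-- In the recurrence the factor `k - β/2` is negative only for `k = 0`, because `β ≤ 2`; the sign
changes once, from `w_0` to `w_1`. -/
theorem weight_nat_succ_nonneg {β : ℝ} (hβ : 0 < β) (hβ₂ : β ≤ 2) (k : ℕ) :
    0 ≤ weight β (k + 1 : ℕ) := by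
  induction k with
  | zero =>
    have h := weight_succ hβ 0
    have h0 := weight_zero_neg hβ
    simp only [Nat.cast_zero, zero_add, Nat.cast_one] at h ⊢
    have : 0 < (1 + β / 2) * weight β 1 := by rw [h]; nlinarith
    exact (pos_of_mul_pos_right this (by positivity)).le
  | succ k ih =>
    have h := weight_succ hβ (k + 1)
    have h1 : (0 : ℝ) ≤ ((k + 1 : ℕ) : ℝ) - β / 2 := by push_cast; linarith [k.cast_nonneg (α := ℝ)]
    have h2 : (0 : ℝ) < ((k + 1 : ℕ) : ℝ) + 1 + β / 2 := by positivity
    exact nonneg_of_mul_nonneg_right (h ▸ mul_nonneg h1 ih) h2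

theorem weight_nonneg {β : ℝ} (hβ : 0 < β) (hβ₂ : β ≤ 2) {k : ℤ} (hk : k ≠ 0) :
    0 ≤ weight β k := by
  have key : ∀ n : ℕ, n ≠ 0 → 0 ≤ weight β n := fun n hn => by
    obtain ⟨m, rfl⟩ := Nat.exists_eq_succ_of_ne_zero hn
    exact weight_nat_succ_nonneg hβ hβ₂ m
  obtain ⟨n, rfl | rfl⟩ := k.eq_nat_or_neg
  · exact key n (by simpa using hk)
  · rw [weight_neg]; exact key n (by simpa using hk)

/-- With `T_k = (k + β/2) w_k` the recurrence reads `T_{k+1} = T_k - β w_k`, so the sum telescopes.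
The sign of the remainder bounds the partial sums. -/
theorem sum_range_weight {β : ℝ} (hβ : 0 < β) (K : ℕ) :
    ∑ k ∈ Finset.range K, weight β k = weight β 0 / 2 - (K + β / 2) * weight β K / β := by
  induction K with
  | zero => simp; field_simp; ring
  | succ K ih =>
    have h := weight_succ hβ K
    rw [Finset.sum_range_succ, ih]
    push_cast at h ⊢
    rw [h]
    field_simp
    ring

theorem summable_weight {β : ℝ} (hβ : 0 < β) (hβ₂ : β ≤ 2) : Summable (weight β) := by
  have h : Summable fun k : ℕ => weight β k := by
    rw [← summable_nat_add_iff 1]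
    refine summable_of_sum_range_le (c := -weight β 0 / 2)
      (fun k => weight_nat_succ_nonneg hβ hβ₂ k) fun n => ?_
    have h1 := sum_range_weight hβ (n + 1)
    rw [Finset.sum_range_succ'] at h1
    have h2 : 0 ≤ (((n + 1 : ℕ) : ℝ) + β / 2) * weight β (n + 1 : ℕ) / β := by
      have := weight_nat_succ_nonneg hβ hβ₂ n
      positivity
    simp only [Nat.cast_zero] at h1
    linarith
  exact Summable.of_nat_of_neg h (by simpa only [weight_neg] using h)

/-! ### The weights as Fourier coefficients. -/

theorem sin_pi_mul_nonneg {x : ℝ} (hx : x ∈ Set.Icc (0 : ℝ) 1) : 0 ≤ Real.sin (Real.pi * x) :=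
  Real.sin_nonneg_of_nonneg_of_le_pi (mul_nonneg Real.pi_pos.le hx.1)
    (mul_le_of_le_one_right Real.pi_pos.le hx.2)

/-- `∫_0^1 (2 sin πx)^β dx` evaluated through the Beta function. -/
theorem integral_two_sin_rpow {β : ℝ} (hβ : 1 < β) :
    ∫ x in (0 : ℝ)..1, (2 * Real.sin (Real.pi * x)) ^ β = -weight β 0 := by
  set q : ℝ := (β - 1) / 2 with hq
  have hq0 : 0 ≤ q := by rw [hq]; linarith
  have hβ0 : 0 < β := by linarith
  have hbeta : ∫ x in (0 : ℝ)..1, (x * (1 - x)) ^ q =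
      Real.Gamma (q + 1) * Real.Gamma (q + 1) / Real.Gamma (q + 1 + (q + 1)) := by
    have h := Complex.betaIntegral_eq_Gamma_mul_div ((q + 1 : ℝ) : ℂ) ((q + 1 : ℝ) : ℂ)
      (by rw [Complex.ofReal_re]; linarith) (by rw [Complex.ofReal_re]; linarith)
    rw [Complex.betaIntegral, ← Complex.ofReal_add, Complex.Gamma_ofReal, Complex.Gamma_ofReal] at h
    have h2 : ∫ x in (0 : ℝ)..1, (x : ℂ) ^ (((q + 1 : ℝ) : ℂ) - 1) *
        (1 - (x : ℂ)) ^ (((q + 1 : ℝ) : ℂ) - 1) =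
        ((∫ x in (0 : ℝ)..1, (x * (1 - x)) ^ q : ℝ) : ℂ) := by
      rw [← intervalIntegral.integral_ofReal]
      refine intervalIntegral.integral_congr fun x hx => ?_
      rw [Set.uIcc_of_le zero_le_one] at hx
      have hx1 : 0 ≤ 1 - x := by linarith [hx.2]
      rw [Real.mul_rpow hx.1 hx1, Complex.ofReal_mul, Complex.ofReal_cpow hx.1,
        Complex.ofReal_cpow hx1]
      push_cast
      rw [add_sub_cancel_right]
    rw [h2] at h
    exact_mod_cast h
  -- Substitute `(1 - cos πt)/2` for `x`: then `x(1 - x) = (sin πt / 2)²`, which with `q = (β -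
  -- 1)/2` and the Jacobian produces `sin^β`.
  have hsub : ∫ x in (0 : ℝ)..1, (x * (1 - x)) ^ q =
      Real.pi * (4 : ℝ) ^ (-β) * ∫ x in (0 : ℝ)..1, (2 * Real.sin (Real.pi * x)) ^ β := by
    have hd : ∀ x ∈ Set.uIcc (0 : ℝ) 1, HasDerivAt
        (fun t : ℝ => (1 - Real.cos (Real.pi * t)) / 2) (Real.pi * Real.sin (Real.pi * x) / 2) x := by
      intro x _
      have h1 : HasDerivAt (fun t : ℝ => Real.pi * t) Real.pi x := by
        simpa using (hasDerivAt_id x).const_mul Real.pi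
      have h2 := ((h1.cos.const_sub 1).div_const 2)
      refine h2.congr_deriv ?_
      ring
    have h := intervalIntegral.integral_comp_mul_deriv (g := fun x : ℝ => (x * (1 - x)) ^ q) hd
      (by fun_prop) ((continuous_id.mul (continuous_const.sub continuous_id)).rpow_const
        fun _ => Or.inr hq0)
    norm_num at h
    rw [← h, ← intervalIntegral.integral_const_mul]
    refine intervalIntegral.integral_congr fun x hx => ?_
    rw [Set.uIcc_of_le zero_le_one] at hx
    have hs := sin_pi_mul_nonneg hx
    have e1 : (1 - Real.cos (Real.pi * x)) / 2 * (1 - (1 - Real.cos (Real.pi * x)) / 2) =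
        (Real.sin (Real.pi * x) / 2) ^ (2 : ℝ) := by
      rw [Real.rpow_two, div_pow, Real.sin_sq]; ring
    rw [e1, ← Real.rpow_mul (by positivity), show 2 * q = β - 1 by rw [hq]; ring]
    have e2 : (4 : ℝ) ^ (-β) = (2 : ℝ) ^ (-β) * (2 : ℝ) ^ (-β) := by
      rw [← Real.mul_rpow (by norm_num) (by norm_num)]; norm_num
    rw [Real.mul_rpow (by norm_num) hs, Real.div_rpow hs (by norm_num), Real.rpow_sub_one' hs,
      Real.rpow_sub_one' (by norm_num), e2, Real.rpow_neg (by norm_num)]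
    · rcases eq_or_ne (Real.sin (Real.pi * x)) 0 with h0 | h0
      · simp [h0, Real.zero_rpow hβ0.ne']
      · field_simp
    all_goals linarith
  -- Legendre duplication trades `Γ(q + 1)` for `Γ(β/2 + 1)`, the factor in `w_0`.
  have hdup := Real.Gamma_mul_Gamma_add_half (q + 1)
  rw [hbeta] at hsub
  rw [show q + 1 + 1 / 2 = β / 2 + 1 by rw [hq]; ring, show 2 * (q + 1) = β + 1 by rw [hq]; ring,
    show 1 - (β + 1) = -β by ring] at hdup
  rw [show q + 1 + (q + 1) = β + 1 by rw [hq]; ring] at hsub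
  have g1 : 0 < Real.Gamma (q + 1) := Real.Gamma_pos_of_pos (by linarith)
  have g2 : 0 < Real.Gamma (β / 2 + 1) := Real.Gamma_pos_of_pos (by linarith)
  have g3 : 0 < Real.Gamma (β + 1) := Real.Gamma_pos_of_pos (by linarith)
  have hp : 0 < (2 : ℝ) ^ (-β) := by positivity
  have e2 : (4 : ℝ) ^ (-β) = (2 : ℝ) ^ (-β) * (2 : ℝ) ^ (-β) := by
    rw [← Real.mul_rpow (by norm_num) (by norm_num)]; norm_num
  have hpi := Real.sq_sqrt Real.pi_pos.le
  unfold weight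
  simp only [zpow_zero, Int.cast_zero, sub_zero, add_zero, one_mul, neg_neg]
  generalize (∫ x in (0 : ℝ)..1, (2 * Real.sin (Real.pi * x)) ^ β) = J at hsub ⊢
  rw [e2, div_eq_iff g3.ne'] at hsub
  rw [eq_div_iff (by positivity)]
  have key : Real.pi * (2 : ℝ) ^ (-β) ^ 2 * Real.Gamma (β + 1) ≠ 0 := by positivity
  generalize (2 : ℝ) ^ (-β) = c at *
  generalize Real.Gamma (q + 1) = A at *
  generalize Real.Gamma (β / 2 + 1) = B at *
  generalize Real.Gamma (β + 1) = D at *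
  have h3 : (A * B) ^ 2 = D ^ 2 * c ^ 2 * Real.pi := by rw [hdup]; linear_combination D ^ 2 * c ^ 2 * hpi
  have h4 : (Real.pi * c ^ 2 * D) * (J * (B * B)) = (Real.pi * c ^ 2 * D) * D := by
    linear_combination (- B ^ 2) * hsub + h3
  exact mul_left_cancel₀ (by positivity) h4

/-- The periodic function `|2 sin πx|^β`. -/
noncomputable def sinSymbol (β : ℝ) (x : ℝ) : ℝ := |2 * Real.sin (Real.pi * x)| ^ β

theorem sinSymbol_periodic (β : ℝ) : Function.Periodic (fun x => (sinSymbol β x : ℂ)) 1 := by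
  intro x
  simp only [sinSymbol, mul_add, mul_one, Real.sin_add_pi, mul_neg, abs_neg]

theorem continuous_sinSymbol {β : ℝ} (hβ : 0 ≤ β) : Continuous (sinSymbol β) := by
  unfold sinSymbol
  exact (by fun_prop : Continuous fun x : ℝ => |2 * Real.sin (Real.pi * x)|).rpow_const
    fun _ => Or.inr hβ

/-- The Fourier coefficients of `|2 sin πx|^β`. -/
noncomputable def sinCoeff (β : ℝ) (n : ℤ) : ℂ :=
  ∫ x in (0 : ℝ)..1, Complex.exp (-(2 * Real.pi * n * x * Complex.I)) * (sinSymbol β x : ℂ)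

/-- The function `(2 sin πx)^{β+1} e^{-iπ(2n+1)x}` vanishes at `0` and `1`, so its derivative
integrates to zero. Splitting sine and cosine into `e^{±iπx}` leaves exactly the two neighbouring
coefficients. -/
theorem sinCoeff_rec {β : ℝ} (hβ : 1 < β) (n : ℤ) :
    (β - 2 * n) * sinCoeff β n + (β + 2 + 2 * n) * sinCoeff β (n + 1) = 0 := by
  have hβ0 : 0 < β := by linarith
  set H : ℝ → ℂ := fun x => ((2 * Real.sin (Real.pi * x)) ^ (β + 1) : ℝ) *
    Complex.exp (-(Real.pi * (2 * n + 1) * x * Complex.I)) with hH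
  have hI : ∀ n : ℤ, IntervalIntegrable (fun x : ℝ =>
      Complex.exp (-(2 * Real.pi * n * x * Complex.I)) * (sinSymbol β x : ℂ))
      MeasureTheory.volume 0 1 := fun n => by
    apply Continuous.intervalIntegrable
    have := continuous_sinSymbol hβ0.le
    fun_prop
  have hd : ∀ x ∈ Set.uIcc (0 : ℝ) 1, HasDerivAt H
      (Real.pi * ((β - 2 * n) * (Complex.exp (-(2 * Real.pi * n * x * Complex.I)) * (sinSymbol β x : ℂ))
        + (β + 2 + 2 * n) * (Complex.exp (-(2 * Real.pi * (n + 1 : ℤ) * x * Complex.I)) *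
          (sinSymbol β x : ℂ)))) x := by
    intro x hx
    rw [Set.uIcc_of_le zero_le_one] at hx
    have hs := sin_pi_mul_nonneg hx
    have h1 : HasDerivAt (fun t : ℝ => Real.pi * t) Real.pi x := by
      simpa using (hasDerivAt_id x).const_mul Real.pi
    have h2 := ((h1.sin.const_mul 2).rpow_const (p := β + 1) (Or.inr (by linarith))).ofReal_comp
    have h3 : HasDerivAt (fun t : ℝ => Complex.exp (-(Real.pi * (2 * n + 1) * t * Complex.I)))
        (Complex.exp (-(Real.pi * (2 * n + 1) * x * Complex.I)) *
          (-(Real.pi * (2 * n + 1) * Complex.I))) x := by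
      have : HasDerivAt (fun t : ℝ => -((Real.pi : ℂ) * (2 * n + 1) * (t : ℂ) * Complex.I))
          (-(Real.pi * (2 * n + 1) * Complex.I)) x := by
        have h := (((hasDerivAt_id x).ofReal_comp).const_mul
          ((Real.pi : ℂ) * (2 * n + 1))).mul_const Complex.I |>.neg
        exact h.congr_deriv (by simp)
      exact this.cexp
    refine (h2.mul h3).congr_deriv ?_
    have e : (2 * Real.sin (Real.pi * x)) ^ (β + 1) =
        (2 * Real.sin (Real.pi * x)) ^ β * (2 * Real.sin (Real.pi * x)) :=
      Real.rpow_add_one' (by positivity) (by linarith)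
    rw [e, add_sub_cancel_right, sinSymbol, abs_of_nonneg (by positivity)]
    generalize (2 * Real.sin (Real.pi * x)) ^ β = S
    have c1 : Complex.exp (-(2 * Real.pi * n * x * Complex.I)) =
        Complex.exp (-(Real.pi * (2 * n + 1) * x * Complex.I)) * Complex.exp (Real.pi * x * Complex.I) := by
      rw [← Complex.exp_add]; congr 1; ring
    have c2 : Complex.exp (-(2 * Real.pi * (n + 1 : ℤ) * x * Complex.I)) =
        Complex.exp (-(Real.pi * (2 * n + 1) * x * Complex.I)) * Complex.exp (-(Real.pi * x) * Complex.I) := by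
      rw [← Complex.exp_add]; congr 1; push_cast; ring
    rw [c1, c2, Complex.exp_mul_I, Complex.exp_mul_I]
    push_cast
    rw [Complex.cos_neg, Complex.sin_neg]
    ring
  have hint := intervalIntegral.integral_eq_sub_of_hasDerivAt hd
    ((((hI n).const_mul _).add ((hI (n + 1)).const_mul _)).const_mul _)
  rw [intervalIntegral.integral_const_mul, intervalIntegral.integral_add ((hI n).const_mul _)
    ((hI (n + 1)).const_mul _), intervalIntegral.integral_const_mul,
    intervalIntegral.integral_const_mul] at hint
  have h0 : H 0 = 0 := by simp [hH, Real.zero_rpow (by linarith : β + 1 ≠ 0)]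
  have h1 : H 1 = 0 := by simp [hH, Real.zero_rpow (by linarith : β + 1 ≠ 0)]
  rw [h0, h1, sub_zero] at hint
  exact (mul_eq_zero.1 hint).resolve_left (by exact_mod_cast Real.pi_ne_zero)

/-- Coefficients and negated weights agree at `0` and obey the same first-order recurrence, whose
leading factor `β + 2 + 2k` never vanishes for `k ≥ 0`; it is run in both directions from `0`. -/
theorem sinCoeff_eq {β : ℝ} (hβ : 1 < β) (n : ℤ) : sinCoeff β n = -(weight β n : ℂ) := by
  have hβ0 : 0 < β := by linarith
  have h0 : sinCoeff β 0 = -(weight β 0 : ℂ) := by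
    rw [← Complex.ofReal_neg, ← integral_two_sin_rpow hβ, ← intervalIntegral.integral_ofReal]
    refine intervalIntegral.integral_congr fun x hx => ?_
    rw [Set.uIcc_of_le zero_le_one] at hx
    have hs := sin_pi_mul_nonneg hx
    simp [sinSymbol, abs_of_nonneg hs]
  have hw : ∀ k : ℕ, ((k : ℂ) + 1 + β / 2) * weight β (k + 1 : ℕ) = (k - β / 2) * weight β k :=
    fun k => by exact_mod_cast weight_succ hβ0 k
  have hne : ∀ k : ℕ, (β + 2 + 2 * k : ℂ) ≠ 0 := fun k => by
    have : (0 : ℝ) < β + 2 + 2 * k := by positivity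
    exact_mod_cast this.ne'
  have hpos : ∀ k : ℕ, sinCoeff β k = -(weight β k : ℂ) := by
    intro k
    induction k with
    | zero => exact_mod_cast h0
    | succ k ih =>
      have h := sinCoeff_rec hβ k
      have hk := hw k
      rw [ih] at h
      refine mul_left_cancel₀ (hne k) ?_
      push_cast at h hk ⊢
      linear_combination h + 2 * hk
  have hneg : ∀ k : ℕ, sinCoeff β (-k) = -(weight β k : ℂ) := by
    intro k
    induction k with
    | zero => exact_mod_cast h0
    | succ k ih =>
      have h := sinCoeff_rec hβ (-(k + 1 : ℕ))
      have hk := hw k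
      rw [show -((k + 1 : ℕ) : ℤ) + 1 = -k by push_cast; ring, ih] at h
      refine mul_left_cancel₀ (hne k) ?_
      push_cast at h hk ⊢
      linear_combination h + 2 * hk
  obtain ⟨k, rfl | rfl⟩ := n.eq_nat_or_neg
  · exact hpos k
  · rw [hneg, weight_neg]

/-- Generating function of the weights. -/
theorem hasSum_weight_exp {β : ℝ} (hβ : 1 < β) (hβ₂ : β ≤ 2) (x : ℝ) :
    HasSum (fun k : ℤ => (weight β k : ℂ) * Complex.exp (2 * Real.pi * k * x * Complex.I))
      (-(sinSymbol β x : ℂ)) := by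
  have hβ0 : 0 < β := by linarith
  have hc : Continuous (sinSymbol_periodic β).lift := by
    refine continuous_coinduced_dom.2 ?_
    exact Complex.continuous_ofReal.comp (continuous_sinSymbol hβ0.le)
  let f : C(AddCircle (1 : ℝ), ℂ) := ⟨(sinSymbol_periodic β).lift, hc⟩
  have hf : ∀ y : ℝ, f (y : AddCircle (1 : ℝ)) = (sinSymbol β y : ℂ) := fun y => rfl
  have hcoef : ∀ n : ℤ, fourierCoeff f n = -(weight β n : ℂ) := fun n => by
    rw [fourierCoeff_eq_intervalIntegral f n 0, ← sinCoeff_eq hβ n, sinCoeff]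
    simp only [div_one, one_smul, zero_add]
    refine intervalIntegral.integral_congr fun y _ => ?_
    simp only [hf, fourier_coe_apply, smul_eq_mul]
    congr 2
    push_cast
    ring
  have hs : Summable (fourierCoeff f) := by
    rw [show fourierCoeff f = fun n => -((weight β n : ℝ) : ℂ) from funext hcoef]
    exact (Complex.ofRealCLM.summable (summable_weight hβ0 hβ₂)).neg
  have h := has_pointwise_sum_fourier_series_of_summable hs (x : AddCircle (1 : ℝ))
  rw [hf] at h
  refine h.neg.congr_fun fun k => ?_
  rw [hcoef, fourier_coe_apply, smul_eq_mul, neg_mul, neg_neg]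
  congr 2
  push_cast
  ring

theorem hasSum_weight {β : ℝ} (hβ : 1 < β) (hβ₂ : β ≤ 2) : HasSum (weight β) 0 := by
  have h := hasSum_weight_exp hβ hβ₂ 0
  have h0 : sinSymbol β 0 = 0 := by simp [sinSymbol, Real.zero_rpow (by linarith : β ≠ 0)]
  rw [h0] at h
  simp only [Complex.ofReal_zero, mul_zero, zero_mul, Complex.exp_zero, mul_one, neg_zero] at h
  exact Complex.hasSum_ofReal.1 (by simpa using h)

/-! ### Maximum-norm stability and unique solvability. -/

theorem abs_le_maxNorm {M : ℕ} (v : Fin (M + 1) → ℝ) {j : Fin (M + 1)} (hj : j ∈ interiorIdx M) :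
    |v j| ≤ maxNorm v := by
  have : ‖v j‖₊ ≤ (interiorIdx M).sup fun j => ‖v j‖₊ := Finset.le_sup (f := fun j => ‖v j‖₊) hj
  exact_mod_cast this

theorem maxNorm_nonneg {M : ℕ} (v : Fin (M + 1) → ℝ) : 0 ≤ maxNorm v := NNReal.coe_nonneg _

theorem maxNorm_le {M : ℕ} {v : Fin (M + 1) → ℝ} {c : ℝ} (hc : 0 ≤ c)
    (h : ∀ j ∈ interiorIdx M, |v j| ≤ c) : maxNorm v ≤ c := by
  lift c to ℝ≥0 using hc
  unfold maxNorm
  rw [NNReal.coe_le_coe]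
  exact Finset.sup_le fun j hj => by exact_mod_cast h j hj

theorem eq_zero_or_mem_interiorIdx {M : ℕ} (j : Fin (M + 1)) :
    j = 0 ∨ j = Fin.last M ∨ j ∈ interiorIdx M := by
  simp only [interiorIdx, Finset.mem_filter, Finset.mem_univ, true_and, Fin.ext_iff, Fin.val_zero,
    Fin.val_last]
  have := j.2
  omega

theorem isFCDSolution_sub {a b α β : ℝ} {M : ℕ} {F G U V : Fin (M + 1) → ℝ}
    (hU : IsFCDSolution a b α β M F U) (hV : IsFCDSolution a b α β M G V) :
    IsFCDSolution a b α β M (fun j => F j - G j) (fun j => U j - V j) where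
  left := by simp [hU.left, hV.left]
  right := by simp [hU.right, hV.right]
  equation j hj := by
    rw [← hU.equation j hj, ← hV.equation j hj]
    simp only [centeredDiff, mul_sub, Finset.sum_sub_distrib]
    ring

/-- The weights sum to zero, and the finite sum including the diagonal omits only nonnegative ones:
this is diagonal dominance of each row. -/
theorem sum_weight_erase_le {β : ℝ} (hβ : 1 < β) (hβ₂ : β ≤ 2) {M : ℕ} (j : Fin (M + 1)) :
    ∑ i ∈ Finset.univ.erase j, weight β (((j : ℕ) : ℤ) - ((i : ℕ) : ℤ)) ≤ -weight β 0 := by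
  have hβ0 : 0 < β := by linarith
  have hinj : Set.InjOn (fun i : Fin (M + 1) => ((j : ℕ) : ℤ) - ((i : ℕ) : ℤ))
      (Finset.univ : Finset (Fin (M + 1))) := fun x _ y _ h => by
    simp only at h
    exact Fin.ext (by omega)
  have h := (hasSum_weight hβ hβ₂).summable.sum_le_tsum
    (Finset.univ.image fun i : Fin (M + 1) => ((j : ℕ) : ℤ) - ((i : ℕ) : ℤ)) fun k hk => by
      refine weight_nonneg hβ0 hβ₂ fun h0 => hk ?_
      exact Finset.mem_image.2 ⟨j, Finset.mem_univ _, by rw [h0, sub_self]⟩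
  rw [(hasSum_weight hβ hβ₂).tsum_eq, Finset.sum_image hinj,
    ← Finset.add_sum_erase _ _ (Finset.mem_univ j), sub_self] at h
  linarith

theorem cos_half_mul_pi_neg {β : ℝ} (hβ : 1 < β) (hβ₂ : β ≤ 2) :
    Real.cos (β * Real.pi / 2) < 0 :=
  Real.cos_neg_of_pi_div_two_lt_of_lt (by nlinarith [Real.pi_pos]) (by nlinarith [Real.pi_pos])

/-- A priori bound for the scheme in the maximum norm. -/
theorem maxNorm_le_of_isFCDSolution {a b α β : ℝ} (hab : a < b) (hα : 0 < α) (hβ : 1 < β)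
    (hβ₂ : β ≤ 2) {M : ℕ} {F U : Fin (M + 1) → ℝ} (h : IsFCDSolution a b α β M F U) :
    maxNorm U ≤ 1 / α * maxNorm F := by
  have hβ0 : 0 < β := by linarith
  rcases (interiorIdx M).eq_empty_or_nonempty with he | hne
  · refine maxNorm_le (mul_nonneg (by positivity) (maxNorm_nonneg _)) fun j hj => ?_
    simp [he] at hj
  obtain ⟨j, hj, hmax⟩ := Finset.exists_max_image (interiorIdx M) (fun j => |U j|) hne
  have hall : ∀ i, |U i| ≤ |U j| := fun i => by
    rcases eq_zero_or_mem_interiorIdx i with rfl | rfl | hi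
    · rw [h.left]; simp
    · rw [h.right]; simp
    · exact hmax i hi
  set d : ℝ := -Real.cos (β * Real.pi / 2) * (1 / step a b M ^ β) with hd
  have hstep : 0 ≤ step a b M := div_nonneg (by linarith) (Nat.cast_nonneg _)
  have hd0 : 0 ≤ d := mul_nonneg (by linarith [cos_half_mul_pi_neg hβ hβ₂])
    (div_nonneg zero_le_one (Real.rpow_nonneg hstep _))
  set S : ℝ := ∑ i ∈ Finset.univ.erase j, weight β (((j : ℕ) : ℤ) - ((i : ℕ) : ℤ)) * U i with hS
  have hS_le : |S| ≤ -weight β 0 * |U j| := by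
    calc |S| ≤ ∑ i ∈ Finset.univ.erase j, |weight β (((j : ℕ) : ℤ) - ((i : ℕ) : ℤ)) * U i| :=
          Finset.abs_sum_le_sum_abs _ _
      _ ≤ ∑ i ∈ Finset.univ.erase j, weight β (((j : ℕ) : ℤ) - ((i : ℕ) : ℤ)) * |U j| := by
          refine Finset.sum_le_sum fun i hi => ?_
          have hw : 0 ≤ weight β (((j : ℕ) : ℤ) - ((i : ℕ) : ℤ)) := by
            refine weight_nonneg hβ0 hβ₂ fun h0 => Finset.ne_of_mem_erase hi (Fin.ext (by omega))
          rw [abs_mul, abs_of_nonneg hw]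
          exact mul_le_mul_of_nonneg_left (hall i) hw
      _ ≤ _ := by
          rw [← Finset.sum_mul]
          exact mul_le_mul_of_nonneg_right (sum_weight_erase_le hβ hβ₂ j) (abs_nonneg _)
  -- The equation at the maximizing node, diagonal isolated. By diagonal dominance the off-diagonal
  -- part is at most `d (-w_0)|U_j|`, which cancels and leaves `α |U_j| ≤ |F_j|`.
  have heq : (α + d * -weight β 0) * U j = F j + d * S := by
    rw [← h.equation j hj, centeredDiff, ← Finset.add_sum_erase _ _ (Finset.mem_univ j), sub_self,
      ← hS, hd]
    ring
  have hw0 : 0 ≤ -weight β 0 := by linarith [weight_zero_neg hβ0]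
  have habs : (α + d * -weight β 0) * |U j| ≤ |F j| + d * (-weight β 0 * |U j|) := by
    rw [← abs_of_nonneg (by positivity : 0 ≤ α + d * -weight β 0), ← abs_mul, heq]
    refine (abs_add_le _ _).trans (add_le_add le_rfl ?_)
    rw [abs_mul, abs_of_nonneg hd0]
    exact mul_le_mul_of_nonneg_left hS_le hd0
  have hfin : α * |U j| ≤ maxNorm F := by
    have := abs_le_maxNorm F hj
    nlinarith
  refine maxNorm_le (mul_nonneg (by positivity) (maxNorm_nonneg _)) fun i _ => (hall i).trans ?_
  rw [one_div, ← div_eq_inv_mul, le_div_iff₀ hα]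
  linarith

/-- The operator of the scheme, acting as the identity on the boundary values. -/
noncomputable def schemeMap (a b α β : ℝ) (M : ℕ) : (Fin (M + 1) → ℝ) →ₗ[ℝ] (Fin (M + 1) → ℝ) where
  toFun U j := if j ∈ interiorIdx M then
    α * U j + Real.cos (β * Real.pi / 2) * centeredDiff a b β M U j else U j
  map_add' U V := by
    funext j
    by_cases hj : j ∈ interiorIdx M
    · simp only [hj, if_true, Pi.add_apply, centeredDiff, mul_add, Finset.sum_add_distrib]; ring
    · simp [hj]
  map_smul' c U := by
    funext j
    by_cases hj : j ∈ interiorIdx M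
    · simp only [hj, if_true, Pi.smul_apply, smul_eq_mul, RingHom.id_apply, centeredDiff,
        mul_left_comm _ c, ← Finset.mul_sum]
      ring
    · simp [hj]

theorem isFCDSolution_iff (a b α β : ℝ) (M : ℕ) (F U : Fin (M + 1) → ℝ) :
    IsFCDSolution a b α β M F U ↔
      schemeMap a b α β M U = fun j => if j ∈ interiorIdx M then F j else 0 := by
  constructor
  · intro h
    funext j
    by_cases hj : j ∈ interiorIdx M
    · simp [schemeMap, hj, h.equation j hj]
    · rcases eq_zero_or_mem_interiorIdx j with rfl | rfl | hi
      · simp [schemeMap, hj, h.left]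
      · simp [schemeMap, hj, h.right]
      · exact absurd hi hj
  · intro h
    have h' := fun j => congrFun h j
    simp only [schemeMap, LinearMap.coe_mk, AddHom.coe_mk] at h'
    refine ⟨?_, ?_, fun j hj => ?_⟩
    · have := h' 0
      simpa [interiorIdx] using this
    · have := h' (Fin.last M)
      simpa [interiorIdx] using this
    · have := h' j
      simpa [hj] using this

theorem existsUnique_isFCDSolution {a b α β : ℝ} (hab : a < b) (hα : 0 < α) (hβ : 1 < β)
    (hβ₂ : β ≤ 2) (M : ℕ) (F : Fin (M + 1) → ℝ) : ∃! U, IsFCDSolution a b α β M F U := by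
  have hinj : Function.Injective (schemeMap a b α β M) := by
    rw [← LinearMap.ker_eq_bot, LinearMap.ker_eq_bot']
    intro U hU
    have hs : IsFCDSolution a b α β M 0 U := (isFCDSolution_iff ..).2 (by rw [hU]; funext j; simp)
    have hb := maxNorm_le_of_isFCDSolution hab hα hβ hβ₂ hs
    have h0 : maxNorm (0 : Fin (M + 1) → ℝ) ≤ 0 := maxNorm_le le_rfl (by simp)
    have hU0 : maxNorm U ≤ 0 := hb.trans (mul_nonpos_of_nonneg_of_nonpos (by positivity) h0)
    funext j
    rcases eq_zero_or_mem_interiorIdx j with rfl | rfl | hi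
    · exact hs.left
    · exact hs.right
    · exact abs_nonpos_iff.1 ((abs_le_maxNorm U hi).trans hU0)
  have hbij : Function.Bijective (schemeMap a b α β M) :=
    ⟨hinj, LinearMap.injective_iff_surjective.1 hinj⟩
  simpa only [isFCDSolution_iff] using hbij.existsUnique fun j => if j ∈ interiorIdx M then F j else 0

/-! ### Fourier transform of the Riesz kernel through Gaussians. -/

open MeasureTheory in
theorem integral_fourier_mul_eq_mul_fourier {f g : ℝ → ℂ} (hf : Integrable f) (hg : Integrable g) :
    ∫ x, 𝓕 f x * g x = ∫ x, f x * 𝓕 g x := by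
  simpa using! VectorFourier.integral_fourierIntegral_smul_eq_flip (L := innerₗ ℝ)
    Real.continuous_fourierChar continuous_inner hf hg

open MeasureTheory in
theorem integral_rpow_mul_gaussian {p x : ℝ} (hp : 0 < p) (hx : x ≠ 0) :
    ∫ t in Set.Ioi (0 : ℝ), t ^ (p - 1) * Real.exp (-(Real.pi * t * x ^ 2)) =
      Real.pi ^ (-p) * Real.Gamma p * |x| ^ (-(2 * p)) := by
  have h := Real.integral_rpow_mul_exp_neg_mul_Ioi hp (r := Real.pi * x ^ 2) (by positivity)
  have e : ∀ t : ℝ, -(Real.pi * t * x ^ 2) = -(Real.pi * x ^ 2 * t) := fun t => by ring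
  simp_rw [e, h]
  rw [one_div, Real.inv_rpow (by positivity), ← Real.rpow_neg (by positivity),
    Real.mul_rpow Real.pi_pos.le (by positivity), ← sq_abs, ← Real.rpow_natCast |x| 2,
    ← Real.rpow_mul (abs_nonneg x)]
  rw [show ((2 : ℕ) : ℝ) * -p = -(2 * p) by push_cast; ring]
  ring

open MeasureTheory in
theorem integrableOn_rpow_mul_gaussian {p x : ℝ} (hp : 0 < p) (hx : x ≠ 0) :
    IntegrableOn (fun t : ℝ => t ^ (p - 1) * Real.exp (-(Real.pi * t * x ^ 2))) (Set.Ioi 0) := by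
  -- A non-integrable function has integral `0` by convention, contradicting the positive closed
  -- form.
  by_contra h
  have h0 := integral_rpow_mul_gaussian hp hx
  rw [integral_undef h] at h0
  have : 0 < Real.pi ^ (-p) * Real.Gamma p * |x| ^ (-(2 * p)) := by
    have := Real.Gamma_pos_of_pos hp
    have := abs_pos.2 hx
    positivity
  exact this.ne h0

open MeasureTheory in
/-- Riesz kernels as superpositions of Gaussians. -/
theorem integral_rpow_mul_integral_gaussian {p : ℝ} (hp : 0 < p) {F : ℝ → ℂ}
    (hFm : AEStronglyMeasurable F)
    (hF : Integrable fun x => ((|x| ^ (-(2 * p)) : ℝ) : ℂ) * F x) :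
    ∫ t in Set.Ioi (0 : ℝ), ((t ^ (p - 1) : ℝ) : ℂ) *
        ∫ x, (Real.exp (-(Real.pi * t * x ^ 2)) : ℂ) * F x =
      ((Real.pi ^ (-p) * Real.Gamma p : ℝ) : ℂ) * ∫ x, ((|x| ^ (-(2 * p)) : ℝ) : ℂ) * F x := by
  have hx0 : ∀ᵐ x : ℝ, x ≠ 0 := by simp [ae_iff]
  have hmeas : AEStronglyMeasurable (fun z : ℝ × ℝ =>
      ((z.1 ^ (p - 1) * Real.exp (-(Real.pi * z.1 * z.2 ^ 2)) : ℝ) : ℂ) * F z.2)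
      ((volume.restrict (Set.Ioi (0 : ℝ))).prod volume) := by
    refine AEStronglyMeasurable.mul (Measurable.aestronglyMeasurable ?_) hFm.comp_snd
    fun_prop
  have hnorm : ∀ t ∈ Set.Ioi (0 : ℝ), ∀ x : ℝ,
      ‖((t ^ (p - 1) * Real.exp (-(Real.pi * t * x ^ 2)) : ℝ) : ℂ) * F x‖ =
      t ^ (p - 1) * Real.exp (-(Real.pi * t * x ^ 2)) * ‖F x‖ := fun t ht x => by
    have : 0 ≤ t ^ (p - 1) := Real.rpow_nonneg (le_of_lt ht) _
    rw [norm_mul, Complex.norm_real, Real.norm_of_nonneg (by positivity)]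
  have hint : Integrable (fun z : ℝ × ℝ =>
      ((z.1 ^ (p - 1) * Real.exp (-(Real.pi * z.1 * z.2 ^ 2)) : ℝ) : ℂ) * F z.2)
      ((volume.restrict (Set.Ioi (0 : ℝ))).prod volume) := by
    rw [integrable_prod_iff' hmeas]
    constructor
    · filter_upwards [hx0] with x hx
      exact ((integrableOn_rpow_mul_gaussian hp hx).ofReal).mul_const _
    · refine (hF.norm.const_mul (Real.pi ^ (-p) * Real.Gamma p)).congr ?_
      filter_upwards [hx0] with x hx
      rw [setIntegral_congr_fun measurableSet_Ioi fun t ht => hnorm t ht x, integral_mul_const,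
        integral_rpow_mul_gaussian hp hx, norm_mul, Complex.norm_real,
        Real.norm_of_nonneg (Real.rpow_nonneg (abs_nonneg x) _)]
      ring
  have hswap := integral_integral_swap (f := fun t x : ℝ =>
    ((t ^ (p - 1) * Real.exp (-(Real.pi * t * x ^ 2)) : ℝ) : ℂ) * F x) hint
  have e1 : ∀ t : ℝ, ((t ^ (p - 1) : ℝ) : ℂ) * ∫ x, (Real.exp (-(Real.pi * t * x ^ 2)) : ℂ) * F x =
      ∫ x, ((t ^ (p - 1) * Real.exp (-(Real.pi * t * x ^ 2)) : ℝ) : ℂ) * F x := fun t => by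
    rw [← integral_const_mul]
    refine integral_congr_ae (.of_forall fun x => ?_)
    simp only
    push_cast
    ring
  simp_rw [e1]
  rw [hswap, ← integral_const_mul]
  refine integral_congr_ae ?_
  filter_upwards [hx0] with x hx
  rw [integral_mul_const, integral_complex_ofReal, integral_rpow_mul_gaussian hp hx]
  push_cast
  ring

open MeasureTheory in
theorem integral_gaussian_mul_fourier {t : ℝ} (ht : 0 < t) {f : ℝ → ℂ} (hf : Integrable f) :
    ∫ x, (Real.exp (-(Real.pi * t * x ^ 2)) : ℂ) * 𝓕 f x =
      ((t ^ (-(1 / 2) : ℝ) : ℝ) : ℂ) * ∫ x, (Real.exp (-(Real.pi * t⁻¹ * x ^ 2)) : ℂ) * f x := by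
  have hg : Integrable fun x : ℝ => Complex.exp (-Real.pi * t * x ^ 2) := by
    have := (integrable_exp_neg_mul_sq (b := Real.pi * t) (by positivity)).ofReal (𝕜 := ℂ)
    refine this.congr (.of_forall fun x => ?_)
    simp
  have h := integral_fourier_mul_eq_mul_fourier hg hf
  rw [fourier_gaussian_pi (by simpa using ht)] at h
  calc _ = ∫ x : ℝ, Complex.exp (-Real.pi * t * x ^ 2) * 𝓕 f x := by
        refine integral_congr_ae (.of_forall fun x => ?_)
        simp
    _ = _ := by
        rw [← h, ← integral_const_mul]
        refine integral_congr_ae (.of_forall fun x => ?_)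
        simp only
        rw [Real.rpow_neg ht.le, Complex.ofReal_inv, Complex.ofReal_cpow ht.le]
        push_cast
        rw [one_div, mul_assoc]
        congr 3
        field_simp

/-- The identity `Γ_ℝ(s)/Γ_ℝ(1 - s) = Γ_ℂ(s) cos(πs/2)` from the functional equation of zeta, in
real form. -/
theorem Gamma_half_quotient {s : ℝ} (hs : 0 < s) (hs1 : s < 1) :
    Real.pi ^ (-(s / 2)) * Real.Gamma (s / 2) =
      Real.pi ^ (-((1 - s) / 2)) * Real.Gamma ((1 - s) / 2) *
        (2 * (2 * Real.pi) ^ (-s) * Real.Gamma s * Real.cos (Real.pi * s / 2)) := by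
  have hR : ∀ r : ℝ, Complex.Gammaℝ r = ((Real.pi ^ (-(r / 2)) * Real.Gamma (r / 2) : ℝ) : ℂ) :=
    fun r => by
      rw [Complex.Gammaℝ_def, Complex.ofReal_mul, Complex.ofReal_cpow Real.pi_pos.le,
        ← Complex.Gamma_ofReal]
      push_cast
      rw [neg_div]
  have hC : Complex.Gammaℂ s = ((2 * (2 * Real.pi) ^ (-s) * Real.Gamma s : ℝ) : ℂ) := by
    rw [Complex.Gammaℂ_def, Complex.ofReal_mul, Complex.ofReal_mul,
      Complex.ofReal_cpow (by positivity), ← Complex.Gamma_ofReal]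
    push_cast
    rfl
  have h := Complex.Gammaℝ_div_Gammaℝ_one_sub (s := s) fun n h => by
    have : s = -(2 * n + 1) := by exact_mod_cast h
    have hn : (0 : ℝ) ≤ n := n.cast_nonneg
    linarith
  have hne : Real.pi ^ (-((1 - s) / 2)) * Real.Gamma ((1 - s) / 2) ≠ 0 := by
    have := Real.Gamma_pos_of_pos (show 0 < (1 - s) / 2 by linarith)
    positivity
  rw [show (1 : ℂ) - s = ((1 - s : ℝ) : ℂ) by push_cast; rfl, hR, hR, hC,
    show (Real.pi : ℂ) * s / 2 = ((Real.pi * s / 2 : ℝ) : ℂ) by push_cast; rfl,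
    ← Complex.ofReal_cos, ← Complex.ofReal_div, ← Complex.ofReal_mul, Complex.ofReal_inj,
    div_eq_iff hne] at h
  rw [h]
  ring

open MeasureTheory in
/-- The Fourier transform of the Riesz kernel, tested against integrable functions. -/
theorem integral_abs_rpow_mul_fourier {s : ℝ} (hs : 0 < s) (hs1 : s < 1) {f : ℝ → ℂ}
    (hf : Integrable f) (hf1 : Integrable fun x => ((|x| ^ (-s) : ℝ) : ℂ) * f x)
    (hf2 : Integrable fun x => ((|x| ^ (s - 1) : ℝ) : ℂ) * 𝓕 f x) :
    ∫ x, ((|x| ^ (s - 1) : ℝ) : ℂ) * 𝓕 f x =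
      ((2 * (2 * Real.pi) ^ (-s) * Real.Gamma s * Real.cos (Real.pi * s / 2) : ℝ) : ℂ) *
        ∫ x, ((|x| ^ (-s) : ℝ) : ℂ) * f x := by
  have hp : 0 < (1 - s) / 2 := by linarith
  have hcont : Continuous (𝓕 f) := VectorFourier.fourierIntegral_continuous
    Real.continuous_fourierChar continuous_inner hf
  have e1 : -(2 * ((1 - s) / 2)) = s - 1 := by ring
  have e2 : -(2 * (s / 2)) = -s := by ring
  have h1 := integral_rpow_mul_integral_gaussian hp hcont.aestronglyMeasurable (by rwa [e1])
  have h2 := integral_rpow_mul_integral_gaussian (half_pos hs) hf.aestronglyMeasurable (by rwa [e2])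
  rw [e1] at h1
  rw [e2] at h2
  -- The Gaussian of parameter `t` transforms into one of parameter `1/t`, so `t ↦ t⁻¹` makes the
  -- two superpositions match.
  rw [← integral_comp_rpow_Ioi _ (show (-1 : ℝ) ≠ 0 by norm_num)] at h2
  have h3 : ∫ t in Set.Ioi (0 : ℝ), ((t ^ ((1 - s) / 2 - 1) : ℝ) : ℂ) *
        ∫ x, (Real.exp (-(Real.pi * t * x ^ 2)) : ℂ) * 𝓕 f x =
      ((Real.pi ^ (-(s / 2)) * Real.Gamma (s / 2) : ℝ) : ℂ) * ∫ x, ((|x| ^ (-s) : ℝ) : ℂ) * f x := by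
    rw [← h2]
    refine setIntegral_congr_fun measurableSet_Ioi fun t ht => ?_
    have ht0 : 0 < t := ht
    rw [integral_gaussian_mul_fourier ht0 hf, Real.rpow_neg_one, ← mul_assoc, ← Complex.ofReal_mul,
      ← Real.rpow_add ht0, Complex.real_smul, ← mul_assoc, ← Complex.ofReal_mul, abs_neg, abs_one,
      one_mul, Real.inv_rpow ht0.le, ← Real.rpow_neg ht0.le, ← Real.rpow_add ht0]
    congr 3
    ring
  rw [h3, Gamma_half_quotient hs hs1, Complex.ofReal_mul, mul_assoc] at h1
  refine (mul_left_cancel₀ ?_ h1).symm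
  have := Real.Gamma_pos_of_pos hp
  exact_mod_cast (by positivity : 0 < Real.pi ^ (-((1 - s) / 2)) * Real.Gamma ((1 - s) / 2)).ne'

open MeasureTheory in
theorem integrable_abs_rpow_indicator {r : ℝ} (hr : -1 < r) :
    Integrable ((Set.Icc (-1 : ℝ) 1).indicator fun x => |x| ^ r) := by
  rw [integrable_indicator_iff measurableSet_Icc]
  have hl : LocallyIntegrable (fun x : ℝ => |x| ^ r) := by
    refine locallyIntegrable_of_norm_le_rpow (C := 1) (α := -r) (by simp)
      (by rw [Module.finrank_self]; push_cast; linarith) (.of_forall fun x => ?_)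
      (Measurable.aestronglyMeasurable (by fun_prop))
    rw [Real.norm_of_nonneg (Real.rpow_nonneg (abs_nonneg x) r), one_mul, Real.norm_eq_abs, neg_neg]
  exact hl.integrableOn_isCompact isCompact_Icc

theorem abs_rpow_le_indicator_add_one {r : ℝ} (hr : r ≤ 0) (x : ℝ) :
    |x| ^ r ≤ (Set.Icc (-1 : ℝ) 1).indicator (fun x => |x| ^ r) x + 1 := by
  by_cases hx : x ∈ Set.Icc (-1 : ℝ) 1
  · rw [Set.indicator_of_mem hx]; linarith
  · rw [Set.indicator_of_notMem hx, zero_add]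
    refine Real.rpow_le_one_of_one_le_of_nonpos ?_ hr
    by_contra! h
    exact hx (abs_le.1 h.le)

-- Near the origin `F` is bounded and the kernel integrable; away from it the kernel is at most `1`
-- and `F` is integrable.
open MeasureTheory in
theorem integrable_abs_rpow_mul {r : ℝ} (hr : -1 < r) (hr0 : r ≤ 0) {F : ℝ → ℂ}
    (hF : Integrable F) {C : ℝ} (hC : ∀ x, ‖F x‖ ≤ C) :
    Integrable fun x => ((|x| ^ r : ℝ) : ℂ) * F x := by
  refine (((integrable_abs_rpow_indicator hr).mul_const C).add hF.norm).mono'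
    ((Measurable.aestronglyMeasurable (by fun_prop)).mul hF.aestronglyMeasurable)
    (.of_forall fun x => ?_)
  rw [norm_mul, Complex.norm_real, Real.norm_of_nonneg (Real.rpow_nonneg (abs_nonneg x) r)]
  refine (mul_le_mul_of_nonneg_right (abs_rpow_le_indicator_add_one hr0 x) (norm_nonneg _)).trans ?_
  rw [add_mul, one_mul]
  refine add_le_add (mul_le_mul_of_nonneg_left (hC x) ?_) le_rfl
  exact Set.indicator_nonneg (fun y _ => Real.rpow_nonneg (abs_nonneg y) r) x

/-! ### Riesz potentials and their Fourier multiplier. -/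

/-- The sum of the two Riemann-Liouville integrals over the line: a Riesz potential. -/
noncomputable def rieszPot (s : ℝ) (v : ℝ → ℝ) (x : ℝ) : ℝ :=
  leftRLIntegral Set.univ s v x + rightRLIntegral Set.univ s v x

open MeasureTheory in
theorem rieszPot_eq_integral {s : ℝ} (hs : 0 < s) {v : ℝ → ℝ} {x : ℝ}
    (h : Integrable fun ζ => v ζ * |x - ζ| ^ (s - 1)) :
    rieszPot s v x = 1 / Real.Gamma s * ∫ ζ, v ζ * |x - ζ| ^ (s - 1) := by
  unfold rieszPot leftRLIntegral rightRLIntegral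
  rw [if_neg hs.ne', if_neg hs.ne', ← mul_add, Set.univ_inter, Set.univ_inter,
    ← integral_add_compl (measurableSet_Iio (a := x)) h, Set.compl_Iio, integral_Ici_eq_integral_Ioi]
  congr 2
  · refine setIntegral_congr_fun measurableSet_Iio fun ζ hζ => ?_
    have hζ' : 0 < x - ζ := sub_pos.2 hζ
    rw [abs_of_pos hζ', div_eq_mul_inv, ← Real.rpow_neg hζ'.le, neg_sub]
  · refine setIntegral_congr_fun measurableSet_Ioi fun ζ hζ => ?_
    have hζ' : 0 < ζ - x := sub_pos.2 hζ
    rw [abs_sub_comm, abs_of_pos hζ', div_eq_mul_inv, ← Real.rpow_neg hζ'.le, neg_sub]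

theorem fourier_exp_mul (χ : ℝ → ℂ) (ζ x : ℝ) :
    𝓕 (fun ω : ℝ => Complex.exp (-(2 * Real.pi * ζ * ω * Complex.I)) * χ ω) x = 𝓕 χ (x + ζ) := by
  rw [Real.fourier_real_eq_integral_exp_smul, Real.fourier_real_eq_integral_exp_smul]
  congr 1
  funext ω
  rw [smul_eq_mul, smul_eq_mul, ← mul_assoc, ← Complex.exp_add]
  congr 2
  push_cast
  ring

open MeasureTheory in
/-- The Fourier multiplier of the Riesz potential, in weak form. -/
theorem integral_rieszPot_mul_fourier {s : ℝ} (hs : 0 ≤ s) (hs1 : s < 1) {v : ℝ → ℝ}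
    (hv : Continuous v) (hvs : HasCompactSupport v) (χ : SchwartzMap ℝ ℂ) :
    ∫ x, (rieszPot s v x : ℂ) * 𝓕 (χ : ℝ → ℂ) x =
      ∫ ω, (2 * Real.cos (Real.pi * s / 2) * |2 * Real.pi * ω| ^ (-s) : ℝ) *
        𝓕 (fun x => (v x : ℂ)) ω * χ ω := by
  have hvi : Integrable fun x => (v x : ℂ) := (hv.integrable_of_hasCompactSupport hvs).ofReal
  have hφi : Integrable (𝓕 (χ : ℝ → ℂ)) := by
    rw [← SchwartzMap.fourier_coe]; exact (𝓕 χ).integrable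
  -- The case `s = 0` is `β = 2`: both one-sided integrals are the identity and the potential is
  -- `2v`.
  rcases hs.eq_or_lt with rfl | hs0
  · have h := integral_fourier_mul_eq_mul_fourier hvi χ.integrable
    simp only [rieszPot, leftRLIntegral, rightRLIntegral, if_true, mul_zero, zero_div, Real.cos_zero,
      neg_zero, Real.rpow_zero, mul_one]
    simp_rw [mul_assoc, integral_const_mul]
    rw [h, ← integral_const_mul]
    congr 1
    funext x
    push_cast
    ring
  obtain ⟨C, hC⟩ : ∃ C, ∀ x, ‖𝓕 (χ : ℝ → ℂ) x‖ ≤ C :=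
    ⟨_, fun x => by rw [← SchwartzMap.fourier_coe]; exact SchwartzMap.norm_le_seminorm ℝ (𝓕 χ) x⟩
  -- Fubini for a singular, non-integrable kernel: its part on `[-1, 1]` is an integrable
  -- convolution factor, the rest is bounded by `1`.
  have hprod : Integrable (fun z : ℝ × ℝ =>
      (v z.2 : ℂ) * ((|z.1 - z.2| ^ (s - 1) : ℝ) : ℂ) * 𝓕 (χ : ℝ → ℂ) z.1)
      (volume.prod volume) := by
    have h1 := ((hvi.norm).convolution_integrand (ContinuousLinearMap.mul ℝ ℝ)
      (integrable_abs_rpow_indicator (r := s - 1) (by linarith)) (μ := volume)).mul_const C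
    have h2 := hφi.norm.mul_prod hvi.norm
    refine (h1.add h2).mono' ?_ (.of_forall fun z => ?_)
    · have hφc : Continuous (𝓕 (χ : ℝ → ℂ)) := by
        rw [← SchwartzMap.fourier_coe]; exact (𝓕 χ).continuous
      have hφm := hφc.measurable
      have hvm := hv.measurable
      refine Measurable.aestronglyMeasurable ?_
      fun_prop
    · rw [norm_mul, norm_mul, Complex.norm_real (|z.1 - z.2| ^ (s - 1)),
        Real.norm_of_nonneg (Real.rpow_nonneg (abs_nonneg _) _)]
      have hk := abs_rpow_le_indicator_add_one (r := s - 1) (by linarith) (z.1 - z.2)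
      have hk0 : 0 ≤ (Set.Icc (-1 : ℝ) 1).indicator (fun x => |x| ^ (s - 1)) (z.1 - z.2) :=
        Set.indicator_nonneg (fun y _ => Real.rpow_nonneg (abs_nonneg y) _) _
      simp only [Pi.add_apply, ContinuousLinearMap.mul_apply']
      have hc := hC z.1
      have n1 := norm_nonneg (v z.2 : ℂ)
      have n2 := norm_nonneg (𝓕 (χ : ℝ → ℂ) z.1)
      generalize (Set.Icc (-1 : ℝ) 1).indicator (fun x => |x| ^ (s - 1)) (z.1 - z.2) = k at *
      calc _ ≤ ‖(v z.2 : ℂ)‖ * (k + 1) * ‖𝓕 (χ : ℝ → ℂ) z.1‖ := by gcongr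
        _ = ‖(v z.2 : ℂ)‖ * k * ‖𝓕 (χ : ℝ → ℂ) z.1‖ + ‖𝓕 (χ : ℝ → ℂ) z.1‖ * ‖(v z.2 : ℂ)‖ := by ring
        _ ≤ _ := by gcongr
  have hGx : ∀ x : ℝ, Integrable fun ζ => v ζ * |x - ζ| ^ (s - 1) := fun x => by
    obtain ⟨B, hB⟩ := hv.bounded_above_of_compact_support hvs
    have h := integrable_abs_rpow_mul (r := s - 1) (by linarith) (by linarith)
      (hvi.comp_sub_left x) (C := B) (fun y => by simpa using hB (x - y))
    have h' := (h.comp_sub_left x).re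
    refine h'.congr (.of_forall fun ζ => ?_)
    simp only [sub_sub_cancel, ← Complex.ofReal_mul]
    rw [RCLike.re_eq_complex_re, Complex.ofReal_re, mul_comm]
  have hchi : ∀ ζ : ℝ, Integrable fun ω : ℝ =>
      Complex.exp (-(2 * Real.pi * ζ * ω * Complex.I)) * χ ω := fun ζ => by
    refine χ.integrable.norm.mono' (by have := χ.continuous; fun_prop) (.of_forall fun ω => ?_)
    rw [norm_mul, show -(2 * Real.pi * ζ * ω * Complex.I) = ((-(2 * Real.pi * ζ * ω) : ℝ) : ℂ) * Complex.I by
      push_cast; ring, Complex.norm_exp_ofReal_mul_I, one_mul]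
  set c : ℝ := 2 * (2 * Real.pi) ^ (-s) * Real.Gamma s * Real.cos (Real.pi * s / 2) with hc
  have hχ1 : Integrable fun ω => ((|ω| ^ (-s) : ℝ) : ℂ) * χ ω :=
    integrable_abs_rpow_mul (by linarith) (by linarith) χ.integrable
      (SchwartzMap.norm_le_seminorm ℝ χ)
  -- Modulating `χ` translates `𝓕 χ`, so the kernel formula at the origin yields it at every `ζ`.
  have hinner : ∀ ζ : ℝ, ∫ x, ((|x - ζ| ^ (s - 1) : ℝ) : ℂ) * 𝓕 (χ : ℝ → ℂ) x =
      c * 𝓕 (fun ω => ((|ω| ^ (-s) : ℝ) : ℂ) * χ ω) ζ := fun ζ => by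
    have h := integral_abs_rpow_mul_fourier hs0 hs1 (hchi ζ) ?_ ?_
    · simp_rw [fourier_exp_mul] at h
      rw [← integral_sub_right_eq_self _ ζ] at h
      simp only [sub_add_cancel] at h
      rw [h, ← hc, Real.fourier_real_eq_integral_exp_smul]
      congr 2
      funext ω
      rw [smul_eq_mul, mul_left_comm]
      congr 2
      push_cast
      ring
    · refine integrable_abs_rpow_mul (by linarith) (by linarith) (hchi ζ)
        (C := SchwartzMap.seminorm ℝ 0 0 χ) fun ω => ?_
      rw [norm_mul, show -(2 * Real.pi * ζ * ω * Complex.I) = ((-(2 * Real.pi * ζ * ω) : ℝ) : ℂ) * Complex.I by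
        push_cast; ring, Complex.norm_exp_ofReal_mul_I, one_mul]
      exact SchwartzMap.norm_le_seminorm ℝ χ ω
    · simp_rw [fourier_exp_mul]
      exact integrable_abs_rpow_mul (by linarith) (by linarith) (hφi.comp_add_right ζ)
        fun x => hC (x + ζ)
  have hΓ : (Real.Gamma s : ℂ) ≠ 0 := by exact_mod_cast (Real.Gamma_pos_of_pos hs0).ne'
  calc ∫ x, (rieszPot s v x : ℂ) * 𝓕 (χ : ℝ → ℂ) x
      = 1 / (Real.Gamma s : ℂ) * ∫ x, ∫ ζ, (v ζ : ℂ) * ((|x - ζ| ^ (s - 1) : ℝ) : ℂ) * 𝓕 (χ : ℝ → ℂ) x := by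
        rw [← integral_const_mul]
        congr 1
        funext x
        rw [integral_mul_const, rieszPot_eq_integral hs0 (hGx x)]
        simp_rw [← Complex.ofReal_mul]
        rw [integral_complex_ofReal]
        push_cast
        ring
    _ = 1 / (Real.Gamma s : ℂ) * ∫ ζ, (v ζ : ℂ) * (c * 𝓕 (fun ω => ((|ω| ^ (-s) : ℝ) : ℂ) * χ ω) ζ) := by
        rw [integral_integral_swap (f := fun x ζ : ℝ =>
          (v ζ : ℂ) * ((|x - ζ| ^ (s - 1) : ℝ) : ℂ) * 𝓕 (χ : ℝ → ℂ) x) hprod]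
        simp_rw [mul_assoc, integral_const_mul, hinner]
    _ = _ := by
        simp_rw [mul_left_comm _ (c : ℂ), integral_const_mul]
        rw [← integral_fourier_mul_eq_mul_fourier hvi hχ1, ← integral_const_mul, ← integral_const_mul]
        congr 1
        funext ω
        rw [hc, abs_mul, abs_of_pos Real.two_pi_pos, Real.mul_rpow Real.two_pi_pos.le (abs_nonneg _)]
        push_cast
        field_simp

/-! ### Integration by parts against Schwartz functions. -/

/-- At most polynomial growth. -/
def PolyGrowth (F : ℝ → ℝ) : Prop := ∃ (C : ℝ) (n : ℕ), ∀ x, |F x| ≤ C * (1 + |x| ^ n)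

theorem PolyGrowth.of_hasDerivAt {F F' : ℝ → ℝ} (hF : ∀ x, HasDerivAt F (F' x) x)
    (h : PolyGrowth F') : PolyGrowth F := by
  obtain ⟨C, n, hC⟩ := h
  have hC0 : 0 ≤ C := by
    by_contra! hneg
    have := hC 0
    have h1 := abs_nonneg (F' 0)
    have h2 : 0 ≤ |(0 : ℝ)| ^ n := by positivity
    nlinarith
  refine ⟨|F 0| + 2 * C, n + 1, fun x => ?_⟩
  have hmv : ‖F x - F 0‖ ≤ C * (1 + |x| ^ n) * ‖x - 0‖ := by
    refine (convex_closedBall (0 : ℝ) |x|).norm_image_sub_le_of_norm_hasDerivWithin_le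
      (fun y _ => (hF y).hasDerivWithinAt) (fun y hy => ?_) (by simp) (by simp)
    rw [mem_closedBall_zero_iff, Real.norm_eq_abs] at hy
    exact (hC y).trans (by gcongr)
  rw [sub_zero, Real.norm_eq_abs, Real.norm_eq_abs] at hmv
  have h1 : |F x| ≤ |F 0| + C * (1 + |x| ^ n) * |x| := by
    have := abs_sub_abs_le_abs_sub (F x) (F 0)
    linarith
  have h2 : |x| ≤ 1 + |x| ^ (n + 1) := by
    rcases le_total |x| 1 with hx | hx
    · have : 0 ≤ |x| ^ (n + 1) := by positivity
      linarith
    · have := le_self_pow₀ hx (Nat.succ_ne_zero n)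
      simp only [Nat.succ_eq_add_one] at this
      linarith
  have h3 : 0 ≤ |x| ^ (n + 1) := by positivity
  have h4 : (1 + |x| ^ n) * |x| = |x| + |x| ^ (n + 1) := by ring
  have h5 := abs_nonneg (F 0)
  have h6 : C * (1 + |x| ^ n) * |x| ≤ 2 * C * (1 + |x| ^ (n + 1)) := by
    rw [mul_assoc, h4]; nlinarith
  nlinarith

open MeasureTheory in
theorem PolyGrowth.of_integrable_deriv {F F' : ℝ → ℝ} (hF : ∀ x, HasDerivAt F (F' x) x)
    (h : Integrable F') : PolyGrowth F := by
  refine ⟨|F 0| + ∫ x, ‖F' x‖, 0, fun x => ?_⟩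
  have h1 := intervalIntegral.integral_eq_sub_of_hasDerivAt (a := 0) (b := x)
    (fun y _ => hF y) h.intervalIntegrable
  have h2 : ‖∫ y in (0 : ℝ)..x, F' y‖ ≤ ∫ x, ‖F' x‖ :=
    (intervalIntegral.norm_integral_le_integral_norm_uIoc).trans
      (setIntegral_le_integral h.norm (.of_forall fun y => norm_nonneg _))
  rw [h1, Real.norm_eq_abs] at h2
  have h3 := abs_sub_abs_le_abs_sub (F x) (F 0)
  have h4 := abs_nonneg (F 0)
  have h5 := integral_nonneg (μ := volume) (f := fun x => ‖F' x‖) fun y => norm_nonneg _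
  simp only [pow_zero]
  linarith

open MeasureTheory in
theorem PolyGrowth.integrable_mul {F : ℝ → ℝ} (h : PolyGrowth F) (hF : Continuous F)
    (φ : SchwartzMap ℝ ℂ) : Integrable fun x => (F x : ℂ) * φ x := by
  obtain ⟨C, n, hC⟩ := h
  refine ((φ.integrable.norm.add (φ.integrable_pow_mul volume n)).const_mul C).mono'
    (by have := φ.continuous; fun_prop) (.of_forall fun x => ?_)
  rw [norm_mul, Complex.norm_real, Real.norm_eq_abs]
  refine (mul_le_mul_of_nonneg_right (hC x) (norm_nonneg _)).trans (le_of_eq ?_)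
  simp only [Pi.add_apply, Real.norm_eq_abs]
  ring

/-- Multiplication by `-2πiω` on Schwartz functions. -/
noncomputable def mulFreq (χ : SchwartzMap ℝ ℂ) : SchwartzMap ℝ ℂ :=
  SchwartzMap.smulLeftCLM ℂ (fun x : ℝ => -2 * (Real.pi : ℂ) * Complex.I * (x : ℂ)) χ

theorem mulFreq_apply (χ : SchwartzMap ℝ ℂ) (x : ℝ) :
    mulFreq χ x = -2 * (Real.pi : ℂ) * Complex.I * (x : ℂ) * χ x := by
  rw [mulFreq, SchwartzMap.smulLeftCLM_apply_apply (by fun_prop), smul_eq_mul]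

open MeasureTheory in
theorem hasDerivAt_fourier_schwartz (χ : SchwartzMap ℝ ℂ) (x : ℝ) :
    HasDerivAt (𝓕 (χ : ℝ → ℂ)) (𝓕 (mulFreq χ : ℝ → ℂ) x) x := by
  have hi : Integrable fun y : ℝ => y • χ y := by
    have := χ.integrable_pow_mul volume 1
    refine this.mono (by have := χ.continuous; fun_prop) (.of_forall fun y => ?_)
    rw [norm_smul, pow_one, norm_mul, norm_norm, norm_norm]
  have h := Real.hasDerivAt_fourier χ.integrable hi x
  have e : (mulFreq χ : ℝ → ℂ) = fun y : ℝ => (-2 * (Real.pi : ℂ) * Complex.I * y) • χ y :=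
    funext fun y => by rw [mulFreq_apply, smul_eq_mul]
  rw [e]
  exact h

-- The derivative of `𝓕 χ` is the transform of `-2πiω χ`. Polynomial growth makes the products
-- integrable, so no boundary terms remain.
open MeasureTheory in
theorem integral_deriv_mul_fourier {F F' : ℝ → ℝ} (hF : ∀ x, HasDerivAt F (F' x) x)
    (hg : PolyGrowth F) (χ : SchwartzMap ℝ ℂ)
    (hi : Integrable fun x => (F' x : ℂ) * 𝓕 (χ : ℝ → ℂ) x) :
    ∫ x, (F' x : ℂ) * 𝓕 (χ : ℝ → ℂ) x = -∫ x, (F x : ℂ) * 𝓕 (mulFreq χ : ℝ → ℂ) x := by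
  have hc : Continuous F := continuous_iff_continuousAt.2 fun x => (hF x).continuousAt
  rw [integral_mul_deriv_eq_deriv_mul_of_integrable (u := fun x => (F x : ℂ))
    (u' := fun x => (F' x : ℂ)) (fun x _ => (hF x).ofReal_comp)
    (fun x _ => hasDerivAt_fourier_schwartz χ x) ?_ hi ?_, neg_neg]
  · exact hg.integrable_mul hc (𝓕 (mulFreq χ))
  · exact hg.integrable_mul hc (𝓕 χ)

open MeasureTheory in
theorem ae_eq_of_integral_mul_schwartz {f g : ℝ → ℂ} (hf : LocallyIntegrable f)
    (hg : LocallyIntegrable g)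
    (h : ∀ χ : SchwartzMap ℝ ℂ, ∫ x, f x * χ x = ∫ x, g x * χ x) : f =ᵐ[volume] g := by
  refine ae_eq_of_integral_contDiff_smul_eq hf hg fun φ hφ hφs => ?_
  have hs : HasCompactSupport fun x => (φ x : ℂ) := hφs.comp_left Complex.ofReal_zero
  have h1 : ∫ x, f x * (φ x : ℂ) = ∫ x, g x * (φ x : ℂ) :=
    h (hs.toSchwartzMap (Complex.ofRealCLM.contDiff.comp hφ))
  simp only [Complex.real_smul]
  simpa only [mul_comm] using h1

open MeasureTheory in
theorem continuous_fourier_of_integrable {f : ℝ → ℂ} (hf : Integrable f) : Continuous (𝓕 f) :=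
  VectorFourier.fourierIntegral_continuous Real.continuous_fourierChar continuous_inner hf

theorem abs_rpow_neg_mul_pow {s : ℝ} {n : ℕ} (hs : s < n) (t : ℝ) :
    |t| ^ (-s) * |t| ^ n = |t| ^ (n - s) := by
  rw [← Real.rpow_natCast, ← Real.rpow_add' (abs_nonneg t) (by linarith), neg_add_eq_sub]

/-- An integrable top derivative makes the third bounded; each integration downwards costs one power
of `|x|`. -/
theorem polyGrowth_of_derivs {D : ℕ → ℝ → ℝ}
    (hD : ∀ k < 4, ∀ x, HasDerivAt (D k) (D (k + 1) x) x)
    (hD4 : MeasureTheory.Integrable (D 4)) : ∀ k < 4, PolyGrowth (D k) := by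
  have h3 := PolyGrowth.of_integrable_deriv (hD 3 (by norm_num)) hD4
  have h2 := h3.of_hasDerivAt (hD 2 (by norm_num))
  have h1 := h2.of_hasDerivAt (hD 1 (by norm_num))
  have h0 := h1.of_hasDerivAt (hD 0 (by norm_num))
  intro k hk
  interval_cases k <;> assumption

open MeasureTheory in
-- Derivatives of the Riesz potential on the Fourier side.
/-- The weak form of `D^k` of a Riesz potential on the Fourier side, for `k = 2`. -/
theorem integral_deriv_two_rieszPot {s : ℝ} (hs : 0 ≤ s) (hs1 : s < 1) {v : ℝ → ℝ}
    (hv : Continuous v) (hvs : HasCompactSupport v) {D : ℕ → ℝ → ℝ} (hD0 : D 0 = rieszPot s v)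
    (hD : ∀ k < 4, ∀ x, HasDerivAt (D k) (D (k + 1) x) x) (hD4 : Integrable (D 4))
    (χ : SchwartzMap ℝ ℂ) :
    ∫ x, (D 2 x : ℂ) * 𝓕 (χ : ℝ → ℂ) x =
      ∫ ω, (-(2 * Real.cos (Real.pi * s / 2)) * |2 * Real.pi * ω| ^ (2 - s) : ℝ) *
        𝓕 (fun x => (v x : ℂ)) ω * χ ω := by
  have hg := polyGrowth_of_derivs hD hD4
  have hc : ∀ k < 4, Continuous (D k) := fun k hk =>
    continuous_iff_continuousAt.2 fun x => (hD k hk x).continuousAt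
  rw [integral_deriv_mul_fourier (hD 1 (by norm_num)) (hg 1 (by norm_num)) χ
      ((hg 2 (by norm_num)).integrable_mul (hc 2 (by norm_num)) (𝓕 χ)),
    integral_deriv_mul_fourier (hD 0 (by norm_num)) (hg 0 (by norm_num)) (mulFreq χ)
      ((hg 1 (by norm_num)).integrable_mul (hc 1 (by norm_num)) (𝓕 (mulFreq χ))),
    neg_neg, hD0, integral_rieszPot_mul_fourier hs hs1 hv hvs]
  congr 1
  funext ω
  rw [mulFreq_apply, mulFreq_apply]
  have h := abs_rpow_neg_mul_pow (n := 2) (s := s) (by push_cast; linarith) (2 * Real.pi * ω)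
  rw [Nat.cast_ofNat, sq_abs] at h
  rw [← h]
  push_cast
  linear_combination (2 * Complex.cos (Real.pi * s / 2) * ((|2 * Real.pi * ω| ^ (-s) : ℝ) : ℂ) *
    𝓕 (fun x => (v x : ℂ)) ω * χ ω * 4 * Real.pi ^ 2 * ω ^ 2) * Complex.I_sq

-- Two more integrations by parts contribute `(-2πiω)² = -|2πω|²`, which flips the sign of the
-- order-two formula.
open MeasureTheory in
theorem integral_deriv_four_rieszPot {s : ℝ} (hs : 0 ≤ s) (hs1 : s < 1) {v : ℝ → ℝ}
    (hv : Continuous v) (hvs : HasCompactSupport v) {D : ℕ → ℝ → ℝ} (hD0 : D 0 = rieszPot s v)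
    (hD : ∀ k < 4, ∀ x, HasDerivAt (D k) (D (k + 1) x) x) (hD4 : Integrable (D 4))
    (χ : SchwartzMap ℝ ℂ) :
    ∫ x, (D 4 x : ℂ) * 𝓕 (χ : ℝ → ℂ) x =
      ∫ ω, (2 * Real.cos (Real.pi * s / 2) * |2 * Real.pi * ω| ^ (4 - s) : ℝ) *
        𝓕 (fun x => (v x : ℂ)) ω * χ ω := by
  have hg := polyGrowth_of_derivs hD hD4
  have hc : ∀ k < 4, Continuous (D k) := fun k hk =>
    continuous_iff_continuousAt.2 fun x => (hD k hk x).continuousAt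
  -- No growth bound is available for the fourth derivative; it is integrable and `𝓕 χ` is bounded.
  have hi4 : Integrable fun x => (D 4 x : ℂ) * 𝓕 (χ : ℝ → ℂ) x :=
    hD4.ofReal.mul_bdd (c := SchwartzMap.seminorm ℝ 0 0 (𝓕 χ))
      (𝓕 χ).continuous.aestronglyMeasurable
      (.of_forall fun x => SchwartzMap.norm_le_seminorm ℝ (𝓕 χ) x)
  rw [integral_deriv_mul_fourier (hD 3 (by norm_num)) (hg 3 (by norm_num)) χ hi4,
    integral_deriv_mul_fourier (hD 2 (by norm_num)) (hg 2 (by norm_num)) (mulFreq χ)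
      ((hg 3 (by norm_num)).integrable_mul (hc 3 (by norm_num)) (𝓕 (mulFreq χ))), neg_neg,
    integral_deriv_two_rieszPot hs hs1 hv hvs hD0 hD hD4]
  congr 1
  funext ω
  rw [mulFreq_apply, mulFreq_apply]
  have h := abs_rpow_neg_mul_pow (n := 2) (s := s - 2) (by push_cast; linarith) (2 * Real.pi * ω)
  rw [Nat.cast_ofNat, sq_abs, neg_sub, show 2 - (s - 2) = 4 - s by ring] at h
  rw [← h]
  push_cast
  linear_combination -(2 * Complex.cos (Real.pi * s / 2) * ((|2 * Real.pi * ω| ^ (2 - s) : ℝ) : ℂ) *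
    𝓕 (fun x => (v x : ℂ)) ω * χ ω * 4 * Real.pi ^ 2 * ω ^ 2) * Complex.I_sq

theorem cos_half_pi_mul_pos {s : ℝ} (hs : 0 ≤ s) (hs1 : s < 1) : 0 < Real.cos (Real.pi * s / 2) :=
  Real.cos_pos_of_mem_Ioo ⟨by nlinarith [Real.pi_pos], by nlinarith [Real.pi_pos]⟩

-- The weak formula identifies the transform of the fourth derivative almost everywhere with the
-- multiplier times `𝓕 v`; as `s < 1`, the constant `2 cos(πs/2)` is nonzero and can be divided out.
open MeasureTheory in
theorem integrable_rpow_mul_fourier {s : ℝ} (hs : 0 ≤ s) (hs1 : s < 1) {v : ℝ → ℝ}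
    (hv : Continuous v) (hvs : HasCompactSupport v) {D : ℕ → ℝ → ℝ} (hD0 : D 0 = rieszPot s v)
    (hD : ∀ k < 4, ∀ x, HasDerivAt (D k) (D (k + 1) x) x) (hD4 : Integrable (D 4))
    (hF : Integrable (𝓕 fun x => (D 4 x : ℂ))) :
    Integrable fun ω => ((|2 * Real.pi * ω| ^ (4 - s) : ℝ) : ℂ) * 𝓕 (fun x => (v x : ℂ)) ω := by
  have hvi : Integrable fun x => (v x : ℂ) := (hv.integrable_of_hasCompactSupport hvs).ofReal
  have hvc := continuous_fourier_of_integrable hvi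
  have hp : Continuous fun ω : ℝ => |2 * Real.pi * ω| ^ (4 - s) :=
    (by fun_prop : Continuous fun ω : ℝ => |2 * Real.pi * ω|).rpow_const
      fun _ => Or.inr (by linarith)
  have hae : (𝓕 fun x => (D 4 x : ℂ)) =ᵐ[volume] fun ω =>
      (2 * Real.cos (Real.pi * s / 2) * |2 * Real.pi * ω| ^ (4 - s) : ℝ) *
        𝓕 (fun x => (v x : ℂ)) ω := by
    refine ae_eq_of_integral_mul_schwartz hF.locallyIntegrable
      (Continuous.locallyIntegrable (by fun_prop)) fun χ => ?_
    have hDi : Integrable fun x => (D 4 x : ℂ) := hD4.ofReal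
    rw [integral_fourier_mul_eq_mul_fourier hDi χ.integrable,
      integral_deriv_four_rieszPot hs hs1 hv hvs hD0 hD hD4]
  have hne : ((2 * Real.cos (Real.pi * s / 2) : ℝ) : ℂ) ≠ 0 := by
    exact_mod_cast (mul_pos two_pos (cos_half_pi_mul_pos hs hs1)).ne'
  refine ((hF.congr hae).const_mul ((2 * Real.cos (Real.pi * s / 2) : ℝ) : ℂ)⁻¹).congr
    (.of_forall fun ω => ?_)
  simp only
  rw [Complex.ofReal_mul (2 * Real.cos (Real.pi * s / 2)), mul_assoc, inv_mul_cancel_left₀ hne]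

open MeasureTheory in
/-- Lower powers of the frequency are integrable against `𝓕 v` as well. -/
theorem integrable_rpow_mul_of_le {p q : ℝ} (hp : 0 ≤ p) (hpq : p ≤ q) {f : ℝ → ℂ}
    (hf : Continuous f)
    (h : Integrable fun ω => ((|2 * Real.pi * ω| ^ q : ℝ) : ℂ) * f ω) :
    Integrable fun ω => ((|2 * Real.pi * ω| ^ p : ℝ) : ℂ) * f ω := by
  have hpc : Continuous fun ω : ℝ => |2 * Real.pi * ω| ^ p :=
    (by fun_prop : Continuous fun ω : ℝ => |2 * Real.pi * ω|).rpow_const fun _ => Or.inr hp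
  have hloc : Integrable ((Set.Icc (-1 : ℝ) 1).indicator
      fun ω => ((|2 * Real.pi * ω| ^ p : ℝ) : ℂ) * f ω) := by
    rw [integrable_indicator_iff measurableSet_Icc]
    exact (by fun_prop : Continuous fun ω => ((|2 * Real.pi * ω| ^ p : ℝ) : ℂ) * f ω)
      |>.continuousOn.integrableOn_compact isCompact_Icc
  refine (hloc.norm.add h.norm).mono' (by fun_prop) (.of_forall fun ω => ?_)
  by_cases hω : ω ∈ Set.Icc (-1 : ℝ) 1
  · simp only [Pi.add_apply, Set.indicator_of_mem hω]
    linarith [norm_nonneg (((|2 * Real.pi * ω| ^ q : ℝ) : ℂ) * f ω)]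
  · simp only [Pi.add_apply, Set.indicator_of_notMem hω, norm_zero, zero_add]
    rw [norm_mul, norm_mul, Complex.norm_real, Complex.norm_real,
      Real.norm_of_nonneg (Real.rpow_nonneg (abs_nonneg _) _),
      Real.norm_of_nonneg (Real.rpow_nonneg (abs_nonneg _) _)]
    refine mul_le_mul_of_nonneg_right (Real.rpow_le_rpow_of_exponent_le ?_ hpq) (norm_nonneg _)
    have h1 : 1 ≤ |ω| := by
      by_contra! h1
      exact hω (abs_le.1 h1.le)
    rw [abs_mul, abs_of_pos Real.two_pi_pos]
    nlinarith [Real.two_le_pi]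

open MeasureTheory in
/-- The second derivative of a regular Riesz potential as an inverse Fourier transform. -/
theorem deriv_two_rieszPot_eq {s : ℝ} (hs : 0 ≤ s) (hs1 : s < 1) {v : ℝ → ℝ}
    (hv : Continuous v) (hvs : HasCompactSupport v) {D : ℕ → ℝ → ℝ} (hD0 : D 0 = rieszPot s v)
    (hD : ∀ k < 4, ∀ x, HasDerivAt (D k) (D (k + 1) x) x) (hD4 : Integrable (D 4))
    (hm : Integrable fun ω => ((|2 * Real.pi * ω| ^ (2 - s) : ℝ) : ℂ) * 𝓕 (fun x => (v x : ℂ)) ω)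
    (x : ℝ) :
    (D 2 x : ℂ) = -(2 * Real.cos (Real.pi * s / 2) : ℝ) *
      𝓕⁻ (fun ω => ((|2 * Real.pi * ω| ^ (2 - s) : ℝ) : ℂ) * 𝓕 (fun x => (v x : ℂ)) ω) x := by
  set m : ℝ → ℂ := fun ω => ((|2 * Real.pi * ω| ^ (2 - s) : ℝ) : ℂ) * 𝓕 (fun x => (v x : ℂ)) ω
  have hc2 : Continuous fun x => (D 2 x : ℂ) := Complex.continuous_ofReal.comp
    (continuous_iff_continuousAt.2 fun x => (hD 2 (by norm_num) x).continuousAt)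
  have hcm : Continuous (𝓕⁻ m) := by
    rw [Real.fourierInv_eq_fourier_comp_neg]
    exact continuous_fourier_of_integrable hm.comp_neg
  have hae : (fun x => (D 2 x : ℂ)) =ᵐ[volume]
      fun x => -(2 * Real.cos (Real.pi * s / 2) : ℝ) * 𝓕⁻ m x := by
    refine ae_eq_of_integral_mul_schwartz hc2.locallyIntegrable
      (Continuous.locallyIntegrable (by fun_prop)) fun φ => ?_
    have h := integral_deriv_two_rieszPot hs hs1 hv hvs hD0 hD hD4 (𝓕⁻ φ)
    have h1 : 𝓕 ((𝓕⁻ φ : SchwartzMap ℝ ℂ) : ℝ → ℂ) = φ := by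
      rw [← SchwartzMap.fourier_coe, FourierTransform.fourier_fourierInv_eq]
    have h2 : ∫ x, 𝓕⁻ m x * φ x = ∫ ω, m ω * (𝓕⁻ φ : SchwartzMap ℝ ℂ) ω := by
      rw [SchwartzMap.fourierInv_coe, Real.fourierInv_eq_fourier_comp_neg,
        integral_fourier_mul_eq_mul_fourier hm.comp_neg φ.integrable, ← integral_neg_eq_self]
      simp only [neg_neg, Real.fourierInv_eq_fourier_neg]
    rw [h1] at h
    rw [h]
    simp_rw [mul_assoc, integral_const_mul]
    rw [h2, ← integral_const_mul]
    congr 1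
    funext ω
    simp only [m]
    simp only [Complex.ofReal_mul, Complex.ofReal_neg, mul_assoc]
  -- Both sides are continuous, so almost everywhere equality holds at every point.
  exact congrFun ((Continuous.ae_eq_iff_eq volume hc2 (by fun_prop)).1 hae) x

/-! ### Second-order consistency on the line. -/

theorem abs_sin_rpow_le {β : ℝ} (hβ : 0 ≤ β) (t : ℝ) : |Real.sin t| ^ β ≤ |t| ^ β :=
  Real.rpow_le_rpow (abs_nonneg _) Real.abs_sin_le_abs hβ

/-- For `t ≥ 1` the right side already exceeds `|t|^β`. For `0 < t ≤ 1`, `sin t ≥ t(1 - t²/4)`, and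
since the base is below `1` and `β ≤ 2`, the power `β` may be replaced by `2`. -/
theorem abs_rpow_sub_abs_sin_rpow_le {β : ℝ} (hβ : 0 < β) (hβ₂ : β ≤ 2) (t : ℝ) :
    |t| ^ β - |Real.sin t| ^ β ≤ |t| ^ β * t ^ 2 := by
  wlog ht : 0 ≤ t generalizing t
  · have := this (-t) (by linarith)
    simpa using this
  rcases ht.eq_or_lt with rfl | ht0
  · simp [Real.zero_rpow hβ.ne']
  rw [abs_of_pos ht0]
  have hp : 0 ≤ t ^ β := by positivity
  rcases le_total 1 t with h1 | h1
  · have h0 : 0 ≤ |Real.sin t| ^ β := by positivity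
    have h2 : t ^ β * 1 ≤ t ^ β * t ^ 2 := mul_le_mul_of_nonneg_left (by nlinarith) hp
    linarith
  have hsin := Real.sin_gt_sub_cube ht0
  have hlow : t * (1 - t ^ 2 / 4) ≤ |Real.sin t| := by
    have := le_abs_self (Real.sin t)
    nlinarith [pow_pos ht0 3]
  have hr0 : 0 < 1 - t ^ 2 / 4 := by nlinarith
  have h2 : t ^ β * (1 - t ^ 2 / 4) ^ (2 : ℝ) ≤ |Real.sin t| ^ β := by
    calc t ^ β * (1 - t ^ 2 / 4) ^ (2 : ℝ) ≤ t ^ β * (1 - t ^ 2 / 4) ^ β := by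
          refine mul_le_mul_of_nonneg_left ?_ hp
          exact Real.rpow_le_rpow_of_exponent_ge hr0 (by nlinarith) hβ₂
      _ = (t * (1 - t ^ 2 / 4)) ^ β := (Real.mul_rpow ht0.le hr0.le).symm
      _ ≤ _ := Real.rpow_le_rpow (by positivity) hlow hβ.le
  rw [Real.rpow_two] at h2
  have h3 : t ^ β * (1 - (1 - t ^ 2 / 4) ^ 2) ≤ t ^ β * t ^ 2 :=
    mul_le_mul_of_nonneg_left (by nlinarith [sq_nonneg (t ^ 2)]) hp
  nlinarith

/-- With `t = πhω` both symbols carry the factor `(2/h)^β`, leaving `|t|^β - |sin t|^β`; the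
constant `1/4` is `t² = (h²/4)(2πω)²`. -/
theorem sinSymbol_consistency {β : ℝ} (hβ : 0 < β) (hβ₂ : β ≤ 2) {h : ℝ} (hh : 0 < h) (ω : ℝ) :
    |(|2 * Real.pi * ω| ^ β - 1 / h ^ β * sinSymbol β (h * ω))| ≤
      h ^ 2 / 4 * |2 * Real.pi * ω| ^ (β + 2) := by
  have hc : 0 ≤ (2 / h) ^ β := by positivity
  have e1 : |2 * Real.pi * ω| ^ β = (2 / h) ^ β * |Real.pi * (h * ω)| ^ β := by
    rw [← Real.mul_rpow (by positivity) (abs_nonneg _), ← abs_of_pos (by positivity : 0 < 2 / h),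
      ← abs_mul]
    congr 2
    field_simp
  have e2 : 1 / h ^ β * sinSymbol β (h * ω) = (2 / h) ^ β * |Real.sin (Real.pi * (h * ω))| ^ β := by
    rw [sinSymbol, abs_mul, abs_two, Real.mul_rpow zero_le_two (abs_nonneg _),
      Real.div_rpow zero_le_two hh.le]
    ring
  have e3 : h ^ 2 / 4 * |2 * Real.pi * ω| ^ (β + 2) =
      (2 / h) ^ β * (|Real.pi * (h * ω)| ^ β * (Real.pi * (h * ω)) ^ 2) := by
    rw [Real.rpow_add' (abs_nonneg _) (by linarith), Real.rpow_two, sq_abs, e1]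
    ring
  rw [e3, e2, e1, ← mul_sub, abs_mul, abs_of_nonneg hc]
  refine mul_le_mul_of_nonneg_left ?_ hc
  rw [abs_of_nonneg (sub_nonneg.2 (abs_sin_rpow_le hβ.le _))]
  exact abs_rpow_sub_abs_sin_rpow_le hβ hβ₂ _

open MeasureTheory in
/-- The symbol of the fractional centered difference. -/
theorem hasSum_weight_mul {β : ℝ} (hβ : 1 < β) (hβ₂ : β ≤ 2) {v : ℝ → ℝ} (hv : Continuous v)
    (hvi : Integrable v) (hF : Integrable (𝓕 fun x => (v x : ℂ))) (h x : ℝ) :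
    HasSum (fun k : ℤ => (weight β k : ℂ) * v (x - k * h))
      (-∫ ω : ℝ, Complex.exp (2 * Real.pi * ω * x * Complex.I) *
        ((sinSymbol β (h * ω) : ℂ) * 𝓕 (fun x => (v x : ℂ)) ω)) := by
  have hvc : Continuous fun x => (v x : ℂ) := Complex.continuous_ofReal.comp hv
  have hviC : Integrable fun x => (v x : ℂ) := hvi.ofReal
  have hinv : ∀ y, (v y : ℂ) = ∫ ω : ℝ, Complex.exp (2 * Real.pi * ω * y * Complex.I) *
      𝓕 (fun x => (v x : ℂ)) ω := fun y => by
    have h1 := congrFun (hvc.fourierInv_fourier_eq hviC hF) y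
    rw [← h1, Real.fourierInv_eq']
    congr 1
    funext ω
    rw [smul_eq_mul]
    congr 2
    simp
    ring
  have hnorm : ∀ θ : ℝ, ‖Complex.exp (2 * Real.pi * θ * Complex.I)‖ = 1 := fun θ => by
    rw [show (2 : ℂ) * Real.pi * θ * Complex.I = ((2 * Real.pi * θ : ℝ) : ℂ) * Complex.I by
      push_cast; ring, Complex.norm_exp_ofReal_mul_I]
  have hbase : ∀ y : ℝ, Integrable fun ω : ℝ => Complex.exp (2 * Real.pi * ω * y * Complex.I) *
      𝓕 (fun x => (v x : ℂ)) ω := fun y => by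
    refine hF.norm.mono' (AEStronglyMeasurable.mul (by fun_prop) hF.aestronglyMeasurable)
      (.of_forall fun ω => ?_)
    have := hnorm (ω * y)
    push_cast at this
    rw [norm_mul, mul_assoc _ (ω : ℂ) (y : ℂ), this, one_mul]
  have hbn : ∀ (y ω : ℝ), ‖Complex.exp (2 * Real.pi * ω * y * Complex.I) *
      𝓕 (fun x => (v x : ℂ)) ω‖ = ‖𝓕 (fun x => (v x : ℂ)) ω‖ := fun y ω => by
    have := hnorm (ω * y)
    push_cast at this
    rw [norm_mul, mul_assoc _ (ω : ℂ) (y : ℂ), this, one_mul]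
  -- Fourier inversion at each shifted point; absolute summability of the weights justifies
  -- exchanging sum and integral.
  have hsum := hasSum_integral_of_summable_integral_norm (μ := volume)
    (F := fun (k : ℤ) (ω : ℝ) => (weight β k : ℂ) *
      (Complex.exp (2 * Real.pi * ω * (x - k * h : ℝ) * Complex.I) * 𝓕 (fun x => (v x : ℂ)) ω))
    (fun k => (hbase _).const_mul _) (by
      simp_rw [norm_mul (weight β _ : ℂ), hbn, integral_const_mul, Complex.norm_real]
      exact (summable_weight (by linarith) hβ₂).norm.mul_right _)
  simp_rw [integral_const_mul, ← hinv] at hsum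
  refine (congrArg (HasSum _) ?_).mp hsum
  symm
  rw [← integral_neg]
  congr 1
  funext ω
  -- A shift by `-kh` multiplies the transform by `e^{-2πikhω}`, so the generating function is
  -- evaluated at `-hω`; the symbol is even.
  have hs := hasSum_weight_exp hβ hβ₂ (-(h * ω))
  have hs' := hs.mul_left (Complex.exp (2 * Real.pi * ω * x * Complex.I) * 𝓕 (fun x => (v x : ℂ)) ω)
  have e : sinSymbol β (-(h * ω)) = sinSymbol β (h * ω) := by simp [sinSymbol]
  rw [e] at hs'
  have e2 : ∀ k : ℤ, Complex.exp (2 * Real.pi * ω * (x - k * h : ℝ) * Complex.I) =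
      Complex.exp (2 * Real.pi * ω * x * Complex.I) *
        Complex.exp (2 * Real.pi * k * (-(h * ω) : ℝ) * Complex.I) := fun k => by
    rw [← Complex.exp_add]
    congr 1
    push_cast
    ring
  rw [show (fun k : ℤ => (weight β k : ℂ) * (Complex.exp (2 * Real.pi * ω * (x - k * h : ℝ) * Complex.I) *
      𝓕 (fun x => (v x : ℂ)) ω)) = fun k : ℤ =>
      Complex.exp (2 * Real.pi * ω * x * Complex.I) * 𝓕 (fun x => (v x : ℂ)) ω *
      ((weight β k : ℂ) * Complex.exp (2 * Real.pi * k * (-(h * ω) : ℝ) * Complex.I)) from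
      funext fun k => by rw [e2]; ring, hs'.tsum_eq]
  ring

open MeasureTheory in
/-- Second-order consistency of the fractional centered difference on the whole line. -/
theorem norm_fcd_sub_le {β : ℝ} (hβ : 1 < β) (hβ₂ : β ≤ 2) {v : ℝ → ℝ} (hv : Continuous v)
    (hvi : Integrable v)
    (hm : Integrable fun ω => ((|2 * Real.pi * ω| ^ (β + 2) : ℝ) : ℂ) * 𝓕 (fun x => (v x : ℂ)) ω)
    {h : ℝ} (hh : 0 < h) (x : ℝ) :
    ‖((1 / h ^ β * ∑' k : ℤ, weight β k * v (x - k * h) : ℝ) : ℂ) +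
      𝓕⁻ (fun ω => ((|2 * Real.pi * ω| ^ β : ℝ) : ℂ) * 𝓕 (fun x => (v x : ℂ)) ω) x‖ ≤
    h ^ 2 / 4 * ∫ ω, ‖((|2 * Real.pi * ω| ^ (β + 2) : ℝ) : ℂ) * 𝓕 (fun x => (v x : ℂ)) ω‖ := by
  have hβ0 : 0 < β := by linarith
  have hviC : Integrable fun x => (v x : ℂ) := hvi.ofReal
  have hFc := continuous_fourier_of_integrable hviC
  have hF : Integrable (𝓕 fun x => (v x : ℂ)) := by
    have := integrable_rpow_mul_of_le le_rfl (by linarith : 0 ≤ β + 2) hFc hm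
    simpa using this
  have hmβ := integrable_rpow_mul_of_le hβ0.le (by linarith : β ≤ β + 2) hFc hm
  have hsum := (hasSum_weight_mul hβ hβ₂ hv hvi hF h x).tsum_eq
  simp_rw [← Complex.ofReal_mul] at hsum
  rw [← Complex.ofReal_tsum] at hsum
  have hnorm : ∀ ω : ℝ, ‖Complex.exp (2 * Real.pi * ω * x * Complex.I)‖ = 1 := fun ω => by
    rw [show (2 : ℂ) * Real.pi * ω * x * Complex.I = ((2 * Real.pi * ω * x : ℝ) : ℂ) * Complex.I by
      push_cast; ring, Complex.norm_exp_ofReal_mul_I]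
  have hi : ∀ g : ℝ → ℂ, Integrable g →
      Integrable fun ω : ℝ => Complex.exp (2 * Real.pi * ω * x * Complex.I) * g ω := fun g hg => by
    refine hg.norm.mono' (AEStronglyMeasurable.mul (by fun_prop) hg.aestronglyMeasurable)
      (.of_forall fun ω => ?_)
    rw [norm_mul, hnorm, one_mul]
  have hsc := continuous_sinSymbol hβ0.le
  have hS : Integrable fun ω : ℝ => (sinSymbol β (h * ω) : ℂ) * 𝓕 (fun x => (v x : ℂ)) ω := by
    refine hF.bdd_mul (c := 2 ^ β) (by fun_prop) (.of_forall fun ω => ?_)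
    rw [Complex.norm_real, sinSymbol, Real.norm_of_nonneg (by positivity)]
    refine Real.rpow_le_rpow (abs_nonneg _) ?_ hβ0.le
    rw [abs_mul, abs_two]
    linarith [Real.abs_sin_le_one (Real.pi * (h * ω))]
  have e : ((1 / h ^ β * ∑' k : ℤ, weight β k * v (x - k * h) : ℝ) : ℂ) +
      𝓕⁻ (fun ω => ((|2 * Real.pi * ω| ^ β : ℝ) : ℂ) * 𝓕 (fun x => (v x : ℂ)) ω) x =
      ∫ ω : ℝ, Complex.exp (2 * Real.pi * ω * x * Complex.I) *
        (((|2 * Real.pi * ω| ^ β - 1 / h ^ β * sinSymbol β (h * ω) : ℝ) : ℂ) *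
          𝓕 (fun x => (v x : ℂ)) ω) := by
    rw [Complex.ofReal_mul, hsum, Real.fourierInv_eq', mul_neg, ← integral_const_mul, neg_add_eq_sub]
    have e1 : (fun ω : ℝ => Complex.exp (((2 * Real.pi * inner ℝ ω x : ℝ) : ℂ) * Complex.I) •
        (((|2 * Real.pi * ω| ^ β : ℝ) : ℂ) * 𝓕 (fun x => (v x : ℂ)) ω)) =
        fun ω : ℝ => Complex.exp (2 * Real.pi * ω * x * Complex.I) *
        (((|2 * Real.pi * ω| ^ β : ℝ) : ℂ) * 𝓕 (fun x => (v x : ℂ)) ω) := by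
      funext ω
      rw [smul_eq_mul]
      congr 2
      simp
      ring
    rw [e1, ← integral_sub (hi _ hmβ) ((hi _ hS).const_mul _)]
    congr 1
    funext ω
    push_cast
    ring
  rw [e, ← integral_const_mul]
  refine norm_integral_le_of_norm_le (hm.norm.const_mul _) (.of_forall fun ω => ?_)
  rw [norm_mul, hnorm, one_mul, norm_mul, norm_mul, Complex.norm_real, Complex.norm_real,
    Real.norm_eq_abs, Real.norm_of_nonneg (Real.rpow_nonneg (abs_nonneg _) _), ← mul_assoc]
  exact mul_le_mul_of_nonneg_right (sinSymbol_consistency hβ0 hβ₂ hh ω) (norm_nonneg _)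

/-! ### From the interval to the line. -/

theorem continuous_zeroExt {a b : ℝ} {u : ℝ → ℝ} (hu : ContinuousOn u (Set.Icc a b))
    (ha : u a = 0) (hb : u b = 0) : Continuous (zeroExt a b u) := by
  rcases le_or_gt a b with hab | hab
  · refine continuous_indicator (fun x hx => ?_) (by rwa [isClosed_Icc.closure_eq])
    rw [frontier_Icc hab] at hx
    rcases hx with rfl | rfl <;> assumption
  · unfold zeroExt
    rw [Set.Icc_eq_empty (not_le.2 hab), Set.indicator_empty]
    exact continuous_const

theorem hasCompactSupport_zeroExt (a b : ℝ) (u : ℝ → ℝ) : HasCompactSupport (zeroExt a b u) :=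
  HasCompactSupport.intro isCompact_Icc fun _ hx => Set.indicator_of_notMem hx u

open MeasureTheory in
theorem leftRLIntegral_Ioo_eq (a b s : ℝ) (u : ℝ → ℝ) {x : ℝ} (hx : x ∈ Set.Ioo a b) :
    leftRLIntegral (Set.Ioo a b) s u x = leftRLIntegral Set.univ s (zeroExt a b u) x := by
  unfold leftRLIntegral
  congr 1
  · rw [zeroExt, Set.indicator_of_mem (Set.Ioo_subset_Icc_self hx)]
  · have e : (fun ζ => zeroExt a b u ζ / (x - ζ) ^ (1 - s)) =
        (Set.Icc a b).indicator fun ζ => u ζ / (x - ζ) ^ (1 - s) := by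
      funext ζ
      by_cases h : ζ ∈ Set.Icc a b <;> simp [zeroExt, h]
    rw [e, setIntegral_indicator measurableSet_Icc, Set.univ_inter, Set.inter_comm,
      setIntegral_congr_set (Filter.EventuallyEq.rfl.inter Ioo_ae_eq_Icc)]

open MeasureTheory in
theorem rightRLIntegral_Ioo_eq (a b s : ℝ) (u : ℝ → ℝ) {x : ℝ} (hx : x ∈ Set.Ioo a b) :
    rightRLIntegral (Set.Ioo a b) s u x = rightRLIntegral Set.univ s (zeroExt a b u) x := by
  unfold rightRLIntegral
  congr 1
  · rw [zeroExt, Set.indicator_of_mem (Set.Ioo_subset_Icc_self hx)]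
  · have e : (fun ζ => zeroExt a b u ζ / (ζ - x) ^ (1 - s)) =
        (Set.Icc a b).indicator fun ζ => u ζ / (ζ - x) ^ (1 - s) := by
      funext ζ
      by_cases h : ζ ∈ Set.Icc a b <;> simp [zeroExt, h]
    rw [e, setIntegral_indicator measurableSet_Icc, Set.univ_inter, Set.inter_comm,
      setIntegral_congr_set (Filter.EventuallyEq.rfl.inter Ioo_ae_eq_Icc)]

/-- Derivatives of the Riesz potential, split into the two one-sided parts. -/
noncomputable def rieszPotDeriv (s : ℝ) (v : ℝ → ℝ) (k : ℕ) (x : ℝ) : ℝ :=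
  iteratedDeriv k (leftRLIntegral Set.univ s v) x + iteratedDeriv k (rightRLIntegral Set.univ s v) x

theorem rieszPotDeriv_zero (s : ℝ) (v : ℝ → ℝ) : rieszPotDeriv s v 0 = rieszPot s v := by
  funext x
  simp [rieszPotDeriv, rieszPot]

theorem natCeil_add_two_eq {β : ℝ} (hβ : 1 < β) (hβ₂ : β ≤ 2) : ⌈β + 2⌉₊ = 4 := by
  rw [Nat.ceil_eq_iff (by norm_num)]
  constructor <;> norm_num <;> linarith

theorem natCeil_eq_two {β : ℝ} (hβ : 1 < β) (hβ₂ : β ≤ 2) : ⌈β⌉₊ = 2 := by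
  rw [Nat.ceil_eq_iff (by norm_num)]
  constructor <;> norm_num <;> linarith

/-- For `1 < β ≤ 2`, `⌈β + 2⌉ - (β + 2) = ⌈β⌉ - β = 2 - β`: the regularity assumption and the
equation differentiate the same potential. -/
theorem hasDerivAt_rieszPotDeriv {β : ℝ} (hβ : 1 < β) (hβ₂ : β ≤ 2) {v : ℝ → ℝ}
    (h : RLDifferentiableOn Set.univ (β + 2) v) (k : ℕ) (hk : k < 4) (x : ℝ) :
    HasDerivAt (rieszPotDeriv (2 - β) v k) (rieszPotDeriv (2 - β) v (k + 1) x) x := by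
  have hx := h x (Set.mem_univ x) k
  rw [natCeil_add_two_eq hβ hβ₂, show ((4 : ℕ) : ℝ) - (β + 2) = 2 - β by push_cast; ring] at hx
  obtain ⟨h1, h2⟩ := hx hk
  unfold rieszPotDeriv
  rw [iteratedDeriv_succ, iteratedDeriv_succ]
  exact h1.hasDerivAt.add h2.hasDerivAt

theorem rieszDeriv_univ_eq {β : ℝ} (hβ : 1 < β) (hβ₂ : β ≤ 2) (v : ℝ → ℝ) (x : ℝ) :
    rieszDeriv Set.univ (β + 2) v x =
      1 / (2 * Real.cos (β * Real.pi / 2)) * rieszPotDeriv (2 - β) v 4 x := by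
  unfold rieszDeriv leftRLDeriv rightRLDeriv rieszPotDeriv
  rw [natCeil_add_two_eq hβ hβ₂, show ((4 : ℕ) : ℝ) - (β + 2) = 2 - β by push_cast; ring,
    show (β + 2) * Real.pi / 2 = β * Real.pi / 2 + Real.pi by ring, Real.cos_add_pi]
  ring

theorem rieszDeriv_Ioo_eq {a b β : ℝ} (hβ : 1 < β) (hβ₂ : β ≤ 2) (u : ℝ → ℝ) {x : ℝ}
    (hx : x ∈ Set.Ioo a b) :
    rieszDeriv (Set.Ioo a b) β u x =
      -(1 / (2 * Real.cos (β * Real.pi / 2))) * rieszPotDeriv (2 - β) (zeroExt a b u) 2 x := by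
  have hnhds : Set.Ioo a b ∈ nhds x := isOpen_Ioo.mem_nhds hx
  unfold rieszDeriv leftRLDeriv rightRLDeriv rieszPotDeriv
  rw [natCeil_eq_two hβ hβ₂, Nat.cast_ofNat,
    Filter.EventuallyEq.iteratedDeriv_eq 2 (Filter.eventually_of_mem hnhds fun y hy =>
      leftRLIntegral_Ioo_eq a b (2 - β) u hy),
    Filter.EventuallyEq.iteratedDeriv_eq 2 (Filter.eventually_of_mem hnhds fun y hy =>
      rightRLIntegral_Ioo_eq a b (2 - β) u hy)]
  ring

theorem step_pos {a b : ℝ} (hab : a < b) {M : ℕ} (hM : 1 ≤ M) : 0 < step a b M :=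
  div_pos (sub_pos.2 hab) (by exact_mod_cast hM)

theorem mul_step {a b : ℝ} {M : ℕ} (hM : 1 ≤ M) : M * step a b M = b - a := by
  have : (M : ℝ) ≠ 0 := by positivity
  unfold step
  field_simp

theorem node_mem_Ioo {a b : ℝ} (hab : a < b) {M : ℕ} (hM : 1 ≤ M) {j : Fin (M + 1)}
    (hj : j ∈ interiorIdx M) : node a b M j ∈ Set.Ioo a b := by
  simp only [interiorIdx, Finset.mem_filter, Finset.mem_univ, true_and] at hj
  have h0 : (0 : ℝ) < (j : ℕ) := by exact_mod_cast hj.1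
  have h1 : ((j : ℕ) : ℝ) < M := by exact_mod_cast hj.2
  have hs := step_pos hab hM
  have hm := mul_step (a := a) (b := b) hM
  unfold node
  constructor <;> nlinarith

/-- The discrete operator on `[a,b]` is the whole-line difference of the zero extension. -/
theorem centeredDiff_eq_tsum {a b : ℝ} (hab : a < b) (β : ℝ) {M : ℕ} (hM : 1 ≤ M) (u : ℝ → ℝ)
    (j : Fin (M + 1)) :
    centeredDiff a b β M (fun i => u (node a b M i)) j = 1 / step a b M ^ β *
      ∑' k : ℤ, weight β k * zeroExt a b u (node a b M j - k * step a b M) := by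
  have hs := step_pos hab hM
  have hm := mul_step (a := a) (b := b) hM
  have hinj : Set.InjOn (fun i : Fin (M + 1) => ((j : ℕ) : ℤ) - ((i : ℕ) : ℤ))
      (Finset.univ : Finset (Fin (M + 1))) := fun x _ y _ h => by
    simp only at h
    exact Fin.ext (by omega)
  unfold centeredDiff
  congr 1
  rw [tsum_eq_sum (s := Finset.univ.image fun i : Fin (M + 1) => ((j : ℕ) : ℤ) - ((i : ℕ) : ℤ)),
    Finset.sum_image hinj]
  · refine Finset.sum_congr rfl fun i _ => ?_
    have e : node a b M j - ((((j : ℕ) : ℤ) - ((i : ℕ) : ℤ) : ℤ) : ℝ) * step a b M = node a b M i := by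
      unfold node; push_cast; ring
    have hi : ((i : ℕ) : ℝ) ≤ M := by exact_mod_cast Nat.lt_succ_iff.1 i.2
    have hi0 : (0 : ℝ) ≤ (i : ℕ) := Nat.cast_nonneg _
    rw [e, zeroExt, Set.indicator_of_mem]
    unfold node
    constructor <;> nlinarith
  · intro k hk
    rw [zeroExt, Set.indicator_of_notMem, mul_zero]
    rintro ⟨h1, h2⟩
    have e : node a b M j - k * step a b M = a + ((((j : ℕ) : ℤ) - k : ℤ) : ℝ) * step a b M := by
      unfold node; push_cast; ring
    rw [e] at h1 h2
    have g1 : (0 : ℝ) ≤ ((((j : ℕ) : ℤ) - k : ℤ) : ℝ) := by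
      by_contra! hneg
      nlinarith
    have g2 : ((((j : ℕ) : ℤ) - k : ℤ) : ℝ) ≤ M := by
      by_contra! hgt
      nlinarith
    have g1' : 0 ≤ ((j : ℕ) : ℤ) - k := by exact_mod_cast g1
    have g2' : ((j : ℕ) : ℤ) - k ≤ M := by exact_mod_cast g2
    refine hk (Finset.mem_image.2 ⟨⟨(((j : ℕ) : ℤ) - k).toNat, by omega⟩, Finset.mem_univ _, ?_⟩)
    simp only
    omega

open MeasureTheory in
/-- Consistency error of the scheme at the interior nodes. -/
theorem exists_consistency_bound {a b α β : ℝ} (hab : a < b) (hβ : 1 < β) (hβ₂ : β ≤ 2)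
    {f u : ℝ → ℝ} (hu : IsRieszSolution a b α β f u) (hreg : IsFCDRegular β (zeroExt a b u)) :
    ∃ K : ℝ, 0 ≤ K ∧ ∀ M : ℕ, 1 ≤ M → ∀ j ∈ interiorIdx M,
      |centeredDiff a b β M (fun i => u (node a b M i)) j -
        rieszDeriv (Set.Ioo a b) β u (node a b M j)| ≤ K * step a b M ^ 2 := by
  set v := zeroExt a b u
  have hv : Continuous v := continuous_zeroExt hu.continuousOn hu.left hu.right
  have hvs : HasCompactSupport v := hasCompactSupport_zeroExt a b u
  have hcos := cos_half_mul_pi_neg hβ hβ₂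
  have hs : 0 ≤ 2 - β := by linarith
  have hs1 : 2 - β < 1 := by linarith
  have hD := hasDerivAt_rieszPotDeriv hβ hβ₂ hreg.differentiable
  have hD0 := rieszPotDeriv_zero (2 - β) v
  have e4 : rieszPotDeriv (2 - β) v 4 =
      fun x => 2 * Real.cos (β * Real.pi / 2) * rieszDeriv Set.univ (β + 2) v x := by
    funext x
    have hne := hcos.ne
    rw [rieszDeriv_univ_eq hβ hβ₂]
    field_simp
  have hD4 : Integrable (rieszPotDeriv (2 - β) v 4) := by
    rw [e4]; exact hreg.integrable_deriv.const_mul _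
  have hF : Integrable (𝓕 fun x => (rieszPotDeriv (2 - β) v 4 x : ℂ)) := by
    have e : (𝓕 fun x => (rieszPotDeriv (2 - β) v 4 x : ℂ)) = fun ω =>
        ((2 * Real.cos (β * Real.pi / 2) : ℝ) : ℂ) *
          𝓕 (fun x : ℝ => (rieszDeriv Set.univ (β + 2) v x : ℂ)) ω := by
      funext ω
      rw [Real.fourier_real_eq_integral_exp_smul, Real.fourier_real_eq_integral_exp_smul,
        ← integral_const_mul]
      congr 1
      funext x
      rw [e4, smul_eq_mul, smul_eq_mul]
      push_cast
      ring
    rw [e]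
    exact hreg.integrable_fourier.const_mul _
  have hm := integrable_rpow_mul_fourier hs hs1 hv hvs hD0 hD hD4 hF
  rw [show 4 - (2 - β) = β + 2 by ring] at hm
  have hFc := continuous_fourier_of_integrable
    (f := fun x => (v x : ℂ)) hreg.integrable.ofReal
  have hm2 := integrable_rpow_mul_of_le (by linarith : 0 ≤ β) (by linarith : β ≤ β + 2) hFc hm
  have hD2 := deriv_two_rieszPot_eq hs hs1 hv hvs hD0 hD hD4
    (by rw [show 2 - (2 - β) = β by ring]; exact hm2)
  -- `cos(π(2 - β)/2) = -cos(βπ/2)`, which cancels the prefactor of the Riesz derivative.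
  rw [show 2 - (2 - β) = β by ring, show Real.pi * (2 - β) / 2 = Real.pi - β * Real.pi / 2 by ring,
    Real.cos_pi_sub] at hD2
  refine ⟨1 / 4 * ∫ ω, ‖((|2 * Real.pi * ω| ^ (β + 2) : ℝ) : ℂ) * 𝓕 (fun x => (v x : ℂ)) ω‖,
    mul_nonneg (by norm_num) (integral_nonneg fun _ => norm_nonneg _), fun M hM j hj => ?_⟩
  have hx := node_mem_Ioo hab hM hj
  have hbound := norm_fcd_sub_le hβ hβ₂ hv hreg.integrable hm (step_pos hab hM) (node a b M j)
  have hR : ((rieszDeriv (Set.Ioo a b) β u (node a b M j) : ℝ) : ℂ) =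
      -𝓕⁻ (fun ω => ((|2 * Real.pi * ω| ^ β : ℝ) : ℂ) * 𝓕 (fun x => (v x : ℂ)) ω) (node a b M j) := by
    have hne : ((Real.cos (β * Real.pi / 2) : ℝ) : ℂ) ≠ 0 := by exact_mod_cast hcos.ne
    rw [rieszDeriv_Ioo_eq hβ hβ₂ u hx, Complex.ofReal_mul, hD2]
    generalize Real.cos (β * Real.pi / 2) = c at hne
    push_cast
    field_simp
  rw [← neg_eq_iff_eq_neg.2 hR, ← sub_eq_add_neg, ← Complex.ofReal_sub, Complex.norm_real,
    ← centeredDiff_eq_tsum hab β hM, Real.norm_eq_abs] at hbound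
  refine hbound.trans (le_of_eq ?_)
  ring

/-! ### Convergence from consistency and stability. -/

theorem node_zero (a b : ℝ) (M : ℕ) : node a b M 0 = a := by simp [node]

theorem node_last {a b : ℝ} {M : ℕ} (hM : 1 ≤ M) : node a b M (Fin.last M) = b := by
  rw [node, Fin.val_last, mul_step hM]
  ring

theorem mainTheorem3 (a b α β : ℝ) (hab : a < b) (hα : 0 < α) (hβ₁ : 1 < β) (hβ₂ : β ≤ 2) :
    -- unique solvability, for every grid and every right-hand side
    (∀ M : ℕ, 1 ≤ M → ∀ F : Fin (M + 1) → ℝ, ∃! U : Fin (M + 1) → ℝ,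
      IsFCDSolution a b α β M F U) ∧
    -- unconditional stability with respect to the right-hand side
    (∃ C : ℝ, 0 < C ∧ ∀ M : ℕ, 1 ≤ M → ∀ F G U V : Fin (M + 1) → ℝ,
      IsFCDSolution a b α β M F U → IsFCDSolution a b α β M G V →
        maxNorm (fun j => U j - V j) ≤ C * maxNorm (fun j => F j - G j)) ∧
    -- second-order convergence in the maximum norm
    (∀ f u : ℝ → ℝ, IsRieszSolution a b α β f u → IsFCDRegular β (zeroExt a b u) →
      ∃ c : ℝ, 0 < c ∧ ∀ M : ℕ, 1 ≤ M → ∀ U : Fin (M + 1) → ℝ,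
        IsFCDSolution a b α β M (fun j => f (node a b M j)) U →
          maxNorm (fun j => u (node a b M j) - U j) ≤ c * step a b M ^ 2) := by
  refine ⟨fun M _ F => existsUnique_isFCDSolution hab hα hβ₁ hβ₂ M F,
    ⟨1 / α, by positivity, fun M _ F G U V hU hV =>
      maxNorm_le_of_isFCDSolution hab hα hβ₁ hβ₂ (isFCDSolution_sub hU hV)⟩, ?_⟩
  intro f u hu hreg
  obtain ⟨K, hK, hbound⟩ := exists_consistency_bound hab hβ₁ hβ₂ hu hreg
  -- The added `1` only makes the constant positive, since `K` may be zero.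
  refine ⟨1 / α * K + 1, by positivity, fun M hM U hU => ?_⟩
  -- The exact nodal values solve the scheme with the right-hand side they themselves generate;
  -- comparing with `U`, the right-hand sides differ by the truncation error.
  have hsol : IsFCDSolution a b α β M (fun j => α * u (node a b M j) +
      Real.cos (β * Real.pi / 2) * centeredDiff a b β M (fun i => u (node a b M i)) j)
      (fun j => u (node a b M j)) :=
    ⟨by rw [node_zero, hu.left], by rw [node_last hM, hu.right], fun j _ => rfl⟩
  have hest := maxNorm_le_of_isFCDSolution hab hα hβ₁ hβ₂ (isFCDSolution_sub hsol hU)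
  have hτ : maxNorm (fun j => α * u (node a b M j) + Real.cos (β * Real.pi / 2) *
      centeredDiff a b β M (fun i => u (node a b M i)) j - f (node a b M j)) ≤
      K * step a b M ^ 2 := by
    refine maxNorm_le (by positivity) fun j hj => ?_
    rw [← hu.equation _ (node_mem_Ioo hab hM hj), add_sub_add_left_eq_sub, ← mul_sub, abs_mul]
    exact (mul_le_of_le_one_left (abs_nonneg _) (Real.abs_cos_le_one _)).trans (hbound M hM j hj)
  calc _ ≤ 1 / α * (K * step a b M ^ 2) := hest.trans (by gcongr)
    _ ≤ (1 / α * K + 1) * step a b M ^ 2 := by nlinarith [sq_nonneg (step a b M)]
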